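/- A $(p,q)$-leaper moves from a square $a$ to any of the squares $a+(\pm p,\pm q)$, $a+(\pm q,\pm p)$. For $m<n$, an $(m,n)$-frame is an $(m+n)\times(m+n)$ chessboard with its central $(n-m)\times(n-m)$ squares removed; extending the sides of the hole dissects it into eight sections $F_i$, where $i$ is one of the eight directions, numbered $0,\dots,7$ counterclockwise from east and taken modulo $8$. The lifting transformations $f,g,h$ take an $(m,n)$-frame $F$ to the concentric $(m,2m+n)$-, $(n,2n-m)$-, $(n,m+2n)$-frame $H$, respectively. They map a set $S$ of squares of $F$ to $\bigcup_i (S+v_i)\cap H_i$, where $v_i$ is the vector in direction $i$ that is a move of a $(0,m+n)$-, $(0,n-m)$-, $(0,m+n)$-leaper for $i=0,2,4,6$ and of an $(m,m)$-, $(n,n)$-, $(n,n)$-leaper for $i=1,3,5,7$, for $f$, $g$, $h$ respectively. Let $L$ be a $(p,q)$-leaper with $0<p<q$, $\gcd(p,q)=1$ and $p+q$ odd. The descent of $L$ is the string $e_1\dots e_l$ over $\{f,g,h\}$ such that applying liftings of types $e_l,\dots,e_1$, in this order, to a $(1,2)$-frame yields a $(p,q)$-frame. Types of cycles of $L$ within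 a $(p+q)\times(p+q)$ chessboard are defined recursively along the descent. The only cycle of a $(1,2)$-leaper, whose squares form the $(1,2)$-frame, is of type $1$. Lifting by $f$ takes each cycle of type $i$ to one of type $i$; lifting by $g$ or $h$ takes each cycle of type $i$ to one of type $i+1$, and the new cycles, which lie in the shell of the larger frame, are of type $1$. (The shell of an $(m,n)$-frame, $m<n\le 3m$, consists of eight square subboards, one in each section. If $n\le 2m$, they have side $n-m$ and are the four corners and the four subboards adjacent by side to the hole; if $n>2m$, they have side $3m-n$ and are in the middles of the four outer sides and adjacent by corner to the hole.) A cycle within a $(p,q)$-frame $F$ is proper if it is a concatenation $a^0a^1\cdots a^7$ of eight disjoint nonempty paths with $a^i$ in $F_i$ such that, for all $i$, the $L$-translation taking $F_i\cup F_{i+1}$ onto $F_{i+5}\cup F_{i+4}$ takes $a^ia^{i+1}$ onto the reverse of $a^{i+5}$ followed by the reverse of $a^{i+4}$. Let $$\frac qp=[c_1\pm,c_2\pm,\dots,c_k]=c_1\pm\cfrac{1}{c_2\pm\cfrac{1}{\ddots\pm\frac1{c_k}}}$$ be the representation of $q/p$ with all $c_i$ even, $c_1\ge 0$ and $c_2,\dots,c_k>0$,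 and let $l_k$ be the numerator in lowest terms of $[c_1\pm,2-,c_2\pm,2-,\dots,c_k]$. **Theorem (third leaper).** We have $c_k=2$ if and only if the descent of $L$ is empty or ends in $g$ or $h$. Suppose that $c_k=2$ and that $l_k$ is not divisible by $3$. Then there is a unique cycle $C$ of $L$ of type $k$ within a $(p+q)\times(p+q)$ chessboard, and there is a Hamiltonian cycle of a $(1,2)$-leaper (knight) over the squares of $C$. More precisely, a proper Hamiltonian cycle of a $(0,1)$-leaper over the squares of $C$ exists, and for every such cycle $a_0,a_1,\dots,a_{N-1}$ (indices modulo $N$) the sequence $a_0,a_3,a_6,\dots,a_{3(N-1)}$ is a Hamiltonian cycle of a $(1,2)$-leaper over the squares of $C$. -/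

import Mathlib

namespace Leaper

/-! Squares of the infinite chessboard are represented by their centers. All boards below are centered
at the origin and have odd side, so that the centers of their squares are integer points. -/

/-- A square of the infinite chessboard. -/
abbrev Square := ℤ × ℤ

/-- `v` is a move of the `(p, q)`-leaper: one of `(±p, ±q)`, `(±q, ±p)`. -/
def IsMove (p q : ℕ) (v : Square) : Prop :=
  (v.1.natAbs = p ∧ v.2.natAbs = q) ∨ (v.1.natAbs = q ∧ v.2.natAbs = p)

/-- The leaper graph of the `(p, q)`-leaper over the infinite chessboard. -/
def leaperGraph (p q : ℕ) : SimpleGraph Square where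
  Adj a b := a ≠ b ∧ IsMove p q (b - a)
  symm := ⟨fun a b h => by
    refine ⟨h.1.symm, ?_⟩
    have h2 := h.2
    simp only [IsMove, Prod.fst_sub, Prod.snd_sub] at h2 ⊢
    omega⟩
  loopless := ⟨fun _ h => h.1 rfl⟩

/-- The leaper graph of the `(p, q)`-leaper over a board `S`. -/
abbrev leaperGraphOn (p q : ℕ) (S : Set Square) : SimpleGraph S := (leaperGraph p q).induce S

/-- There is a Hamiltonian cycle of the `(p, q)`-leaper over the squares of `S`. -/
def IsToured (p q : ℕ) (S : Set Square) : Prop :=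
  ∃ (a : S) (w : (leaperGraphOn p q S).Walk a a), w.IsHamiltonianCycle

/-- The `(p + q) × (p + q)` chessboard centered at the origin (for `p + q` odd). -/
def board (p q : ℕ) : Set Square :=
  {s | |2 * s.1| < (p + q : ℤ) ∧ |2 * s.2| < (p + q : ℤ)}

/-- `S` is the vertex set of a cycle of the `(p, q)`-leaper within the `(p + q) × (p + q)` board. -/
def IsCycleSet (p q : ℕ) (S : Set Square) : Prop :=
  S ⊆ board p q ∧ IsToured p q S

/-! ### Frames and sections -/

/-- The eight directions E, NE, N, NW, W, SW, S, SE, numbered counterclockwise from `0`. Addition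
of `Fin 8` is cyclic, so `i + k` is `k` steps counterclockwise from `i`, and `i + 4` is opposite `i`. -/
abbrev Dir := Fin 8

/-- The horizontal and vertical signs of a direction. -/
def dirVec : Dir → Square :=
  ![(1, 0), (1, 1), (0, 1), (-1, 1), (-1, 0), (-1, -1), (0, -1), (1, -1)]

/-- The range of a coordinate of the squares of a section of the `(m, n)`-frame,
`d` being the sign of the direction of the section along that coordinate. -/
def strip (m n : ℕ) (d x : ℤ) : Prop :=
  if d = 0 then |2 * x| < (n - m : ℤ)
  else (n - m : ℤ) < 2 * (d * x) ∧ 2 * (d * x) < (m + n : ℤ)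

/-- The section in direction `i` of the `(m, n)`-frame, `m < n`, `m + n` odd, centered at the origin. -/
def frameSection (m n : ℕ) (i : Dir) : Set Square :=
  {s | strip m n (dirVec i).1 s.1 ∧ strip m n (dirVec i).2 s.2}

/-- The `(m, n)`-frame: the `(m + n) × (m + n)` board without its central `(n - m) × (n - m)` hole. -/
def frame (m n : ℕ) : Set Square :=
  board m n \ {s | |2 * s.1| < (n - m : ℤ) ∧ |2 * s.2| < (n - m : ℤ)}

/-- The shell of an `(m, n)`-frame, `m < n ≤ 3 m`: eight square subboards, one in each section.
If `n ≤ 2 m`, they have side `n - m` and are the four corners and the four subboards adjacent by side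
to the hole; if `2 m < n`, they have side `3 m - n` and are in the middles of the four outer sides and
adjacent by corner to the hole. -/
def shell (m n : ℕ) : Set Square :=
  {s | ∃ i : Dir, s ∈ frameSection m n i ∧
    if (dirVec i).1 ≠ 0 ∧ (dirVec i).2 ≠ 0 then
      -- a corner section
      if n ≤ 2 * m then
        (3 * m - n : ℤ) < 2 * |s.1| ∧ (3 * m - n : ℤ) < 2 * |s.2|
      else
        2 * |s.1| < (5 * m - n : ℤ) ∧ 2 * |s.2| < (5 * m - n : ℤ)
    else
      -- a side section
      if n ≤ 2 * m then
        2 * max |s.1| |s.2| < (3 * (n - m) : ℤ)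
      else
        (3 * n - 5 * m : ℤ) < 2 * max |s.1| |s.2| ∧ 2 * min |s.1| |s.2| < (3 * m - n : ℤ)}

/-! ### Lifting transformations, descents, and types of cycles -/

/-- The three lifting transformations. -/
inductive Lifting
  | f
  | g
  | h

/-- The proportions of the frame to which an `(m, n)`-frame is lifted. -/
def Lifting.target : Lifting → ℕ × ℕ → ℕ × ℕ
  | .f, (m, n) => (m, 2 * m + n)
  | .g, (m, n) => (n, 2 * n - m)
  | .h, (m, n) => (n, m + 2 * n)

/-- The translation in direction `i` of the given lifting of an `(m, n)`-frame: a move of a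
`(0, m + n)`-, `(0, n - m)`-, `(0, m + n)`-leaper towards E, N, W, S, and of an
`(m, m)`-, `(n, n)`-, `(n, n)`-leaper towards NE, NW, SW, SE, for `f`, `g`, `h`, respectively. -/
def Lifting.shift (t : Lifting) (m n : ℕ) (i : Dir) : Square :=
  let side : ℤ := match t with
    | .f => m + n
    | .g => n - m
    | .h => m + n
  let corner : ℤ := match t with
    | .f => m
    | .g => n
    | .h => n
  (if (dirVec i).1 ≠ 0 ∧ (dirVec i).2 ≠ 0 then corner else side) • dirVec i

/-- The image of a set `S` of squares of the `(m, n)`-frame under a lifting transformation. -/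
def Lifting.lift (t : Lifting) (m n : ℕ) (S : Set Square) : Set Square :=
  {b | ∃ i : Dir, b ∈ frameSection (t.target (m, n)).1 (t.target (m, n)).2 i ∧
    b - t.shift m n i ∈ S}

/-- The frame to which liftings of types `e_l`, …, `e_2`, `e_1`, in this order,
lift the `(1, 2)`-frame. -/
def frameOfWord : List Lifting → ℕ × ℕ
  | [] => (1, 2)
  | t :: e => t.target (frameOfWord e)

/-- The word `e` is the descent of the `(p, q)`-leaper. -/
def IsDescent (p q : ℕ) (e : List Lifting) : Prop := frameOfWord e = (p, q)

/-- `CycleOfWord e i S`: `S` is the vertex set of a cycle of type `i` of the leaper of descent `e`.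
The only cycle of the `(1, 2)`-leaper is of type `1`. Lifting by `f` extends each cycle and preserves
its type. Lifting by `g` or `h` extends each cycle of type `i` to one of type `i + 1`, and
the new cycles, within the shell, are of type `1`. -/
inductive CycleOfWord : List Lifting → ℕ → Set Square → Prop
  | base : CycleOfWord [] 1 (frame 1 2)
  | lift_f {e : List Lifting} {i : ℕ} {S : Set Square} : CycleOfWord e i S →
      CycleOfWord (.f :: e) i (Lifting.f.lift (frameOfWord e).1 (frameOfWord e).2 S)
  | lift_g {e : List Lifting} {i : ℕ} {S : Set Square} : CycleOfWord e i S →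
      CycleOfWord (.g :: e) (i + 1) (Lifting.g.lift (frameOfWord e).1 (frameOfWord e).2 S)
  | lift_h {e : List Lifting} {i : ℕ} {S : Set Square} : CycleOfWord e i S →
      CycleOfWord (.h :: e) (i + 1) (Lifting.h.lift (frameOfWord e).1 (frameOfWord e).2 S)
  | shell_g {e : List Lifting} {S : Set Square} :
      IsCycleSet (frameOfWord (.g :: e)).1 (frameOfWord (.g :: e)).2 S →
      S ⊆ shell (frameOfWord (.g :: e)).1 (frameOfWord (.g :: e)).2 →
      CycleOfWord (.g :: e) 1 S
  | shell_h {e : List Lifting} {S : Set Square} :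
      IsCycleSet (frameOfWord (.h :: e)).1 (frameOfWord (.h :: e)).2 S →
      S ⊆ shell (frameOfWord (.h :: e)).1 (frameOfWord (.h :: e)).2 →
      CycleOfWord (.h :: e) 1 S

/-- `S` is the vertex set of a cycle of type `i` of the skew basic `(p, q)`-leaper, `p < q`. -/
def IsCycleOfType (p q i : ℕ) (S : Set Square) : Prop :=
  ∃ e : List Lifting, IsDescent p q e ∧ CycleOfWord e i S

/-! ### Proper cycles -/

/-- The `(m, n)`-leaper translation that maps the union of the sections `i` and `i + 1`
of the `(m, n)`-frame onto the union of the sections opposite them. -/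
def frameShift (m n : ℕ) : Dir → Square :=
  ![(-n, -m), (-m, -n), (m, -n), (n, -m), (n, m), (m, n), (-m, n), (-n, m)]

/-- The cyclic sequence of squares `D`, traversed counterclockwise, is proper within
the `(m, n)`-frame: it is a concatenation of eight nonempty paths `a 0`, …, `a 7`, one in each section,
such that the translation above maps `a i` followed by `a (i + 1)` onto
the reverse of `a (i + 5)` followed by the reverse of `a (i + 4)`. -/
def IsProperSeq (m n : ℕ) (D : List Square) : Prop :=
  ∃ a : Dir → List Square,
    D ~r (List.ofFn a).flatten ∧
    (∀ i, a i ≠ [] ∧ ∀ s ∈ a i, s ∈ frameSection m n i) ∧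
    ∀ i, (a i ++ a (i + 1)).map (· + frameShift m n i) = (a (i + 5)).reverse ++ (a (i + 4)).reverse

/-- The Hamiltonian cycle `w` of the `(r, s)`-leaper over `C`, traversed in either direction,
is proper within the `(m, n)`-frame. (The list `w.support.tail` has each square of `C` once.) -/
def IsProperTour (m n : ℕ) {r s : ℕ} {C : Set Square} {a : C}
    (w : (leaperGraphOn r s C).Walk a a) : Prop :=
  w.IsHamiltonianCycle ∧
    (IsProperSeq m n (w.support.tail.map Subtype.val) ∨
      IsProperSeq m n (w.support.tail.map Subtype.val).reverse)

/-! ### Even continued fractions -/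

/-- `c₁ ± 1 / (c₂ ± 1 / (… ± 1 / c_k))`, where `init` lists the terms `c₁`, …, `c_{k-1}`, each with
the sign that follows it, and `last` is `c_k`. -/
def cfValue (init : List (ℕ × ℤˣ)) (last : ℕ) : ℚ :=
  init.foldr (fun t x => (t.1 : ℚ) + ((t.2 : ℤ) : ℚ) / x) (last : ℚ)

/-- All terms are even and nonnegative, and all terms but the first one are positive. -/
def IsEvenCF (init : List (ℕ × ℤˣ)) (last : ℕ) : Prop :=
  (∀ c ∈ init.map Prod.fst ++ [last], Even c) ∧
    ∀ c ∈ (init.map Prod.fst ++ [last]).tail, 0 < c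

/-- `[c₁±, 2-, c₂±, 2-, …, c_k]`. -/
def interleavedValue (init : List (ℕ × ℤˣ)) (last : ℕ) : ℚ :=
  cfValue (init.flatMap fun t => [t, (2, -1)]) last

end Leaper

namespace Leaper

/-!
Each lifting turns a path in every section of a frame into a path in every section of the larger
frame: the translates of the paths in the sections around `i`, or around the opposite direction
`i + 4` and backwards, fit together end to end in section `i`. Hence the squares of the oldest cycle
of each leaper are threaded by a closed path of steps of the `(0, 1)`-leaper through the eight
sections, a *track*, which starts from the eight squares around the center of the `3 × 3` board.

Leaper moves between squares of a track are the translations between opposite pairs of sections,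
two from each square, and the lifted squares stay connected by them; so they do form one cycle.
Squares of a track that are adjacent on the board are consecutive on the track. Therefore the
Hamiltonian cycle of the `(0, 1)`-leaper is unique up to its starting square and its direction.

Every stretch of four squares of the lifted track is the translate of such a stretch of the original
one, up to reversal. Hence once squares three steps apart on a track differ by a knight move, they
keep doing so under all liftings; this holds for the eight squares around the center, and after
lifting these by `g` or `h`. If the paths in the sections to the sides and at the corners of the
hole have `x` and `y` squares, then the track has `4 * (x + y)` squares, and `(x + y) / y` follows
the recursion of the interleaved continued fraction, so that `x + y` is its numerator. Every third
square of the track thus makes up a single cycle when `3` does not divide this numerator.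
-/

/-! ### Distances along lists -/

/-- Any two elements of the list at distance `d` are related by `R`, in the order of the list. -/
def Spaced {α : Type*} (d : ℕ) (R : α → α → Prop) (l : List α) : Prop :=
  ∀ k u v, l[k]? = some u → l[k + d]? = some v → R u v

namespace Spaced
variable {α β : Type*} {d : ℕ} {R : α → α → Prop} {l l' A B C : List α}

theorem of_infix (h : Spaced d R l') (hl : l <:+: l') : Spaced d R l := by
  obtain ⟨c, -, hcl⟩ := List.infix_iff_getElem?.1 hl
  have shifted {k : ℕ} {u : α} (hu : l[k]? = some u) : l'[k + c]? = some u := by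
    obtain ⟨hk, rfl⟩ := List.getElem?_eq_some_iff.1 hu
    exact hcl k hk
  intro k u v hu hv
  refine h (k + c) u v (shifted hu) ?_
  rw [Nat.add_right_comm]
  exact shifted hv

theorem glue (hB : d ≤ B.length) (hAB : Spaced d R (A ++ B)) (hBC : Spaced d R (B ++ C)) :
    Spaced d R (A ++ B ++ C) := by
  intro k u v hu hv
  rcases lt_or_ge (k + d) (A ++ B).length with hk | hk
  · rw [List.getElem?_append_left (by omega)] at hu hv
    exact hAB k u v hu hv
  · rw [List.length_append] at hk
    rw [List.append_assoc, List.getElem?_append_right (by omega)] at hu hv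
    refine hBC (k - A.length) u v hu ?_
    rwa [← Nat.sub_add_comm (by omega)]

theorem reverse [Std.Symm R] (h : Spaced d R l) : Spaced d R l.reverse := by
  intro k u v hu hv
  have hk : k + d < l.length := by simpa using (List.getElem?_eq_some_iff.1 hv).1
  rw [List.getElem?_reverse (by omega)] at hu hv
  refine Std.Symm.symm _ _ (h (l.length - 1 - (k + d)) v u hv ?_)
  rwa [show l.length - 1 - (k + d) + d = l.length - 1 - k by omega]

theorem map {S : β → β → Prop} {f : α → β} (hR : ∀ u v, R u v → S (f u) (f v))
    (h : Spaced d R l) : Spaced d S (l.map f) := by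
  intro k u v hu hv
  rw [List.getElem?_map, Option.map_eq_some_iff] at hu hv
  obtain ⟨u', hu, rfl⟩ := hu
  obtain ⟨v', hv, rfl⟩ := hv
  exact hR _ _ (h k u' v' hu hv)

end Spaced

/-- Any two elements of the list that are related by `R` are consecutive. -/
def Tight {α : Type*} (R : α → α → Prop) (l : List α) : Prop :=
  ∀ u ∈ l, ∀ v ∈ l, R u v → [u, v] <:+: l ∨ [v, u] <:+: l

namespace Tight
variable {α β : Type*} {R : α → α → Prop} {l A B C : List α}

theorem reverse (h : Tight R l) : Tight R l.reverse := fun u hu v hv huv =>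
  (h u (List.mem_reverse.1 hu) v (List.mem_reverse.1 hv) huv).symm.imp .reverse .reverse

theorem map {S : β → β → Prop} {f : α → β} (hR : ∀ u v, S (f u) (f v) → R u v)
    (h : Tight R l) : Tight S (l.map f) := by
  simp only [Tight, List.forall_mem_map]
  exact fun u hu v hv huv => (h u hu v hv (hR u v huv)).imp (fun h => h.map f) (fun h => h.map f)

theorem glue [Std.Symm R] (hAB : Tight R (A ++ B)) (hBC : Tight R (B ++ C))
    (hAC : ∀ u ∈ A, ∀ v ∈ C, ¬ R u v) : Tight R (A ++ B ++ C) := by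
  have common (u v : α) (hu : u ∈ A ++ B ++ C) (hv : v ∈ A ++ B ++ C) (huv : R u v) :
      (u ∈ A ++ B ∧ v ∈ A ++ B) ∨ (u ∈ B ++ C ∧ v ∈ B ++ C) := by
    have := hAC u
    have := hAC v
    have := Std.Symm.symm u v huv
    simp only [List.mem_append] at hu hv ⊢
    grind
  intro u hu v hv huv
  rcases common u v hu hv huv with ⟨hu, hv⟩ | ⟨hu, hv⟩
  · exact (hAB u hu v hv huv).imp List.infix_append_of_infix_left List.infix_append_of_infix_left
  · rw [List.append_assoc]
    exact (hBC u hu v hv huv).imp List.infix_append_of_infix_right List.infix_append_of_infix_right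

end Tight

/-- The `k` consecutive directions that start with `i`. -/
def dirArc (i : Dir) (k : ℕ) : List Dir := List.iterate (· + 1) i k

open scoped Fin.CommRing in
theorem dirArc_add (i : Dir) (k l : ℕ) : dirArc i (k + l) = dirArc i k ++ dirArc (i + k) l := by
  simp [dirArc, List.iterate_add]

/-- The concatenation of the paths in `k` consecutive directions, the first one being `i`. -/
def arc {α : Type*} (a : Dir → List α) (i : Dir) (k : ℕ) : List α := (dirArc i k).flatMap a

section arc
variable {α : Type*} (a : Dir → List α) (i : Dir)

theorem arc_succ (k : ℕ) : arc a i (k + 1) = a i ++ arc a (i + 1) k := rfl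

theorem arc_one : arc a i 1 = a i := by simp [arc, dirArc]

theorem arc_two : arc a i 2 = a i ++ a (i + 1) := by simp [arc, dirArc]

open scoped Fin.CommRing in
theorem arc_add (k l : ℕ) : arc a i (k + l) = arc a i k ++ arc a (i + k) l := by
  rw [arc, dirArc_add, List.flatMap_append, arc, arc]

end arc

/-! ### Sections of frames -/

section Geometry
variable {m n : ℕ}

theorem strip_zero_iff {x : ℤ} : strip m n 0 x ↔ (m - n : ℤ) < 2 * x ∧ 2 * x < n - m := by
  rw [strip, if_pos rfl, abs_lt, neg_sub]

theorem strip_one_iff {x : ℤ} : strip m n 1 x ↔ (n - m : ℤ) < 2 * x ∧ 2 * x < m + n := by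
  rw [strip, if_neg one_ne_zero, one_mul]

theorem strip_neg_one_iff {x : ℤ} :
    strip m n (-1) x ↔ 2 * x < (m - n : ℤ) ∧ -(m + n : ℤ) < 2 * x := by
  rw [strip, if_neg (by decide)]
  omega

/-- `d` is the sign of a direction along a coordinate. -/
def IsSign (d : ℤ) : Prop := d = 0 ∨ d = 1 ∨ d = -1

theorem isSign_dirVec (i : Dir) : IsSign (dirVec i).1 ∧ IsSign (dirVec i).2 := by
  simp only [IsSign]
  decide +revert

theorem abs_lt_of_strip {d x : ℤ} (hd : IsSign d) (hx : strip m n d x) :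
    |2 * x| < (m + n : ℤ) := by
  rw [abs_lt]
  rcases hd with rfl | rfl | rfl <;>
    simp only [strip_zero_iff, strip_one_iff, strip_neg_one_iff] at hx <;> omega

theorem sign_sub_le_of_strip {d e x z : ℤ} (hd : IsSign d) (he : IsSign e) (hmn : m < n)
    (hx : strip m n d x) (hz : strip m n e z) (hxz : (x - z).natAbs ≤ 1) :
    (d - e).natAbs ≤ (x - z).natAbs := by
  rcases hd with rfl | rfl | rfl <;> rcases he with rfl | rfl | rfl <;>
    simp only [strip_zero_iff, strip_one_iff, strip_neg_one_iff] at hx hz <;> omega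

theorem frameSection_subset_board (i : Dir) : frameSection m n i ⊆ board m n :=
  fun _ hs => ⟨abs_lt_of_strip (isSign_dirVec i).1 hs.1, abs_lt_of_strip (isSign_dirVec i).2 hs.2⟩

theorem eq_of_mem_frameSection {s : Square} {i j : Dir} (hmn : m < n)
    (hi : s ∈ frameSection m n i) (hj : s ∈ frameSection m n j) : i = j := by
  have h₁ := sign_sub_le_of_strip (isSign_dirVec i).1 (isSign_dirVec j).1 hmn hi.1 hj.1 (by simp)
  have h₂ := sign_sub_le_of_strip (isSign_dirVec i).2 (isSign_dirVec j).2 hmn hi.2 hj.2 (by simp)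
  rw [sub_self, Int.natAbs_zero] at h₁ h₂
  clear hi hj
  decide +revert

/-- The `(p, q)`-leaper moves between the squares `u` and `v`. Unlike the adjacency of
`leaperGraph`, this does not require the squares to be distinct. -/
def IsLeap (p q : ℕ) (u v : Square) : Prop := IsMove p q (v - u)

instance (p q : ℕ) : Std.Symm (IsLeap p q) where
  symm u v h := by
    simp only [IsLeap, IsMove, Prod.fst_sub, Prod.snd_sub] at h ⊢
    omega

theorem isLeap_add_right_iff {p q : ℕ} {u v w : Square} :
    IsLeap p q (u + w) (v + w) ↔ IsLeap p q u v := by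
  rw [IsLeap, IsLeap, add_sub_add_right_eq_sub]

theorem eq_or_eq_add_one_or_eq_sub_one_of_isLeap {s r : Square} {i j : Dir} (hmn : m < n)
    (hi : s ∈ frameSection m n i) (hj : r ∈ frameSection m n j) (h : IsLeap 0 1 s r) :
    j = i ∨ j = i + 1 ∨ j = i - 1 := by
  simp only [IsLeap, IsMove, Prod.fst_sub, Prod.snd_sub] at h
  have h₁ := sign_sub_le_of_strip (isSign_dirVec j).1 (isSign_dirVec i).1 hmn hj.1 hi.1 (by omega)
  have h₂ := sign_sub_le_of_strip (isSign_dirVec j).2 (isSign_dirVec i).2 hmn hj.2 hi.2 (by omega)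
  have hij : ((dirVec j).1 - (dirVec i).1).natAbs + ((dirVec j).2 - (dirVec i).2).natAbs ≤ 1 := by
    omega
  clear h hi hj h₁ h₂
  decide +revert

theorem eq_add_frameShift_of_isLeap {s r : Square} {i : Dir} (hm : 0 < m) (hmn : m < n)
    (hs : s ∈ frameSection m n i) (hr : r ∈ board m n) (h : IsLeap m n s r) :
    r = s + frameShift m n i ∨ r = s + frameShift m n (i - 1) := by
  obtain ⟨x, y⟩ := s
  obtain ⟨z, w⟩ := r
  simp only [IsLeap, IsMove, Prod.fst_sub, Prod.snd_sub] at h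
  simp only [board, Set.mem_ofPred_eq, abs_lt] at hr
  fin_cases i <;>
    simp [frameSection, strip_zero_iff, strip_one_iff, strip_neg_one_iff, dirVec,
      frameShift] at hs ⊢ <;>
    omega

end Geometry

namespace Lifting

/-- The sections that `t` shifts into section `i` of the target frame are consecutive, and centered
at `i` or at the opposite direction `i + 4`. In the former case, there are two fewer of them than in
the latter, and `i` is short. -/
def IsShort (t : Lifting) (i : Dir) : Prop :=
  match t with
  | .f => i.val % 2 = 1
  | .g => i.val % 2 = 0
  | .h => i.val % 2 = 1

instance (t : Lifting) : DecidablePred t.IsShort := fun i =>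
  match t with
  | .f => inferInstanceAs (Decidable (i.val % 2 = 1))
  | .g => inferInstanceAs (Decidable (i.val % 2 = 0))
  | .h => inferInstanceAs (Decidable (i.val % 2 = 1))

/-- How far from a short direction `i` are the sections shifted into section `i` by `t`. -/
def radius : Lifting → ℕ
  | .f => 0
  | .g => 0
  | .h => 1

open scoped Fin.CommRing in
/-- The directions of the sections of the smaller frame that `t` shifts into section `i`. -/
def sources (t : Lifting) (i : Dir) : List Dir :=
  if t.IsShort i then dirArc (i - t.radius) (2 * t.radius + 1)
  else dirArc (i + 3 - t.radius) (2 * t.radius + 3)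

section Geometry
variable {m n : ℕ}

/-- The nonzero coordinate of the translations of the lifting `t` towards E, N, W, S. -/
def sideStep (t : Lifting) (m n : ℕ) : ℤ :=
  match t with
  | .f => m + n
  | .g => n - m
  | .h => m + n

/-- Both coordinates, up to sign, of the translations of the lifting `t` towards the corners. -/
def cornerStep (t : Lifting) (m n : ℕ) : ℤ :=
  match t with
  | .f => m
  | .g => n
  | .h => n

/-- Along a coordinate where a translation of `t` towards a side has sign `d`, a strip of sign `e`
is translated into the strip of sign `d` of the target. -/
def SideFits (t : Lifting) (d e : ℤ) : Prop :=
  match t with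
  | .f => d = 0 ∨ e = -d
  | .g => e = 0 ∨ e = d
  | .h => d = 0 ∨ e = 0 ∨ e = -d

/-- Along a coordinate where a translation of `t` towards a corner has sign `d`, a strip of sign `e`
is translated into the strip of sign `d` of the target. -/
def CornerFits (t : Lifting) (d e : ℤ) : Prop :=
  match t with
  | .f => e = d
  | .g => e = 0 ∨ e = -d
  | .h => e = 0 ∨ e = d

instance (t : Lifting) (d e : ℤ) : Decidable (t.SideFits d e) := by
  cases t <;> unfold SideFits <;> infer_instance

instance (t : Lifting) (d e : ℤ) : Decidable (t.CornerFits d e) := by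
  cases t <;> unfold CornerFits <;> infer_instance

theorem strip_sideStep_iff (t : Lifting) {d e x : ℤ} (hm : 0 < m) (hmn : m < n) (hd : IsSign d)
    (he : IsSign e) (hx : strip m n e x) :
    strip (t.target (m, n)).1 (t.target (m, n)).2 d (x + t.sideStep m n * d) ↔ t.SideFits d e := by
  cases t <;> rcases hd with rfl | rfl | rfl <;> rcases he with rfl | rfl | rfl <;>
    simp [strip_zero_iff, strip_one_iff, strip_neg_one_iff, target, sideStep, SideFits] at hx ⊢ <;>
    omega

theorem strip_cornerStep_iff (t : Lifting) {d e x : ℤ} (hm : 0 < m) (hmn : m < n)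
    (hd : d = 1 ∨ d = -1) (he : IsSign e) (hx : strip m n e x) :
    strip (t.target (m, n)).1 (t.target (m, n)).2 d (x + t.cornerStep m n * d) ↔
      t.CornerFits d e := by
  cases t <;> rcases hd with rfl | rfl <;> rcases he with rfl | rfl | rfl <;>
    simp [strip_zero_iff, strip_one_iff, strip_neg_one_iff, target, cornerStep, CornerFits]
      at hx ⊢ <;>
    omega

theorem add_shift_mem_frameSection_iff (t : Lifting) {s : Square} {i j : Dir} (hm : 0 < m)
    (hmn : m < n) (hs : s ∈ frameSection m n j) :
    s + t.shift m n i ∈ frameSection (t.target (m, n)).1 (t.target (m, n)).2 i ↔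
      j ∈ t.sources i := by
  have hi := isSign_dirVec i
  have hj := isSign_dirVec j
  have fits : (if (dirVec i).1 ≠ 0 ∧ (dirVec i).2 ≠ 0
      then t.CornerFits (dirVec i).1 (dirVec j).1 ∧ t.CornerFits (dirVec i).2 (dirVec j).2
      else t.SideFits (dirVec i).1 (dirVec j).1 ∧ t.SideFits (dirVec i).2 (dirVec j).2) ↔
      j ∈ t.sources i := by
    clear hs hi hj
    cases t <;> decide +revert
  rw [← fits]
  have hshift : t.shift m n i = (if (dirVec i).1 ≠ 0 ∧ (dirVec i).2 ≠ 0 then t.cornerStep m n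
    else t.sideStep m n) • dirVec i := by cases t <;> rfl
  rw [hshift]
  split_ifs with hc
  · exact and_congr
      (t.strip_cornerStep_iff hm hmn (hi.1.resolve_left hc.1) hj.1 hs.1)
      (t.strip_cornerStep_iff hm hmn (hi.2.resolve_left hc.2) hj.2 hs.2)
  · exact and_congr (t.strip_sideStep_iff hm hmn hi.1 hj.1 hs.1)
      (t.strip_sideStep_iff hm hmn hi.2 hj.2 hs.2)

end Geometry
end Lifting

/-- The translation of a list of squares by the vector `v`. -/
def translate (v : Square) (l : List Square) : List Square := l.map (· + v)

section translate
variable (v w : Square) (l l' : List Square)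

theorem translate_append : translate v (l ++ l') = translate v l ++ translate v l' :=
  List.map_append

theorem translate_reverse : translate v l.reverse = (translate v l).reverse := List.map_reverse

theorem translate_translate : translate w (translate v l) = translate (v + w) l := by
  simp [translate, Function.comp_def, add_assoc]

theorem length_translate : (translate v l).length = l.length := List.length_map _

variable {v l} in
theorem mem_translate {s : Square} : s ∈ translate v l ↔ s - v ∈ l := by
  simp [translate, ← eq_sub_iff_add_eq]

end translate

theorem Tight.translate {p q : ℕ} {l : List Square} (v : Square) (h : Tight (IsLeap p q) l) :
    Tight (IsLeap p q) (translate v l) := h.map fun _ _ => isLeap_add_right_iff.1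

theorem Spaced.translate {d p q : ℕ} {l : List Square} (v : Square)
    (h : Spaced d (IsLeap p q) l) : Spaced d (IsLeap p q) (translate v l) :=
  h.map fun _ _ => isLeap_add_right_iff.2

namespace Lifting
section Geometry
variable {m n : ℕ} {i j k : Dir} {u v : Square}

theorem shift_add_frameShift (t : Lifting) (hmn : m < n) (i : Dir) :
    t.shift m n i + frameShift (t.target (m, n)).1 (t.target (m, n)).2 i = t.shift m n (i + 5) := by
  cases t <;> fin_cases i <;> simp [target, shift, frameShift, dirVec] <;> omega

open scoped Fin.CommRing in
theorem shift_add_one (t : Lifting) (hi : t.IsShort i) :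
    t.shift m n (i + 1) = frameShift m n (i + t.radius + 5) + t.shift m n i := by
  cases t <;> fin_cases i <;>
    simp [IsShort, radius, shift, frameShift, dirVec] at hi ⊢ <;> omega

open scoped Fin.CommRing in
theorem shift_sub_one (t : Lifting) (hi : t.IsShort i) :
    t.shift m n (i - 1) = frameShift m n (i - t.radius + 2) + t.shift m n i := by
  cases t <;> fin_cases i <;>
    simp [IsShort, radius, shift, frameShift, dirVec] at hi ⊢ <;> omega

theorem eq_or_of_mem_sources_add_four (t : Lifting) (hi : t.IsShort i)
    (hj : j ∈ t.sources (i + 4)) : j = i + 4 ∨ t = .h ∧ (j = i + 3 ∨ j = i + 5) := by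
  cases t <;> simp only [reduceCtorEq, false_and, true_and, or_false] <;> decide +revert

theorem not_isLeap (t : Lifting) (hmn : m < n) (hi : t.IsShort i) (hj : j ∈ t.sources (i + 4))
    (hk : k = i + 1 ∨ k = i - 1)
    (hu : u ∈ frameSection (t.target (m, n)).1 (t.target (m, n)).2 i)
    (hv : v ∈ frameSection m n j) : ¬ IsLeap 0 1 u (v + t.shift m n k) := by
  obtain ⟨x, y⟩ := u
  obtain ⟨z, w⟩ := v
  rcases t.eq_or_of_mem_sources_add_four hi hj with rfl | ⟨rfl, rfl | rfl⟩
  on_goal 1 => cases t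
  all_goals
    rcases hk with rfl | rfl <;> fin_cases i <;> simp [IsShort] at hi <;>
      simp [frameSection, strip_zero_iff, strip_one_iff, strip_neg_one_iff, dirVec, target, shift,
        IsLeap, IsMove] at hu hv ⊢ <;>
      omega

end Geometry
end Lifting

/-! ### Tracks -/

/-- The path in section `i` of the lifted frame that is made up of the translated paths of the
smaller frame. It is traversed backwards when it comes from the sections opposite to `i`. -/
def Lifting.path (t : Lifting) (m n : ℕ) (a : Dir → List Square) (i : Dir) : List Square :=
  translate (t.shift m n i)
    (if t.IsShort i then (t.sources i).flatMap a else ((t.sources i).flatMap a).reverse)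

/-- A system of paths, one in each section of the `(m, n)`-frame, of lengths `x` and `y` in
the sections to the sides and at the corners of the hole, respectively, that is invariant under the
translations of opposite sections, and whose squares are adjacent only along the paths. -/
structure IsTrack (m n x y : ℕ) (a : Dir → List Square) : Prop where
  pos : 0 < m
  lt : m < n
  pos_x : 0 < x
  pos_y : 0 < y
  length_eq : ∀ i, (a i).length = if i.val % 2 = 0 then x else y
  mem : ∀ i, ∀ s ∈ a i, s ∈ frameSection m n i
  nodup : ∀ i, (a i).Nodup
  shift : ∀ i, translate (frameShift m n i) (arc a i 2) = (arc a (i + 4) 2).reverse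
  tight : ∀ i, Tight (IsLeap 0 1) (arc a i 2)

namespace IsTrack
variable {m n x y : ℕ} {a : Dir → List Square} (T : IsTrack m n x y a) {i : Dir}
include T

theorem ne_nil (i : Dir) : a i ≠ [] := by
  rw [← List.length_pos_iff, T.length_eq]
  split_ifs
  exacts [T.pos_x, T.pos_y]

theorem length_arc_two (i : Dir) : (arc a i 2).length = x + y := by
  rw [arc_two, List.length_append, T.length_eq, T.length_eq]
  fin_cases i <;> simp [add_comm]

theorem le_length_arc {k : ℕ} (hk : 2 ≤ k) (i : Dir) : x + y ≤ (arc a i k).length := by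
  obtain ⟨l, rfl⟩ := Nat.exists_eq_add_of_le hk
  rw [arc_add, List.length_append, T.length_arc_two]
  exact Nat.le_add_right _ _

theorem nodup_arc {k : ℕ} (hk : k ≤ 8) (i : Dir) : (arc a i k).Nodup := by
  rw [arc, List.nodup_flatMap]
  refine ⟨fun j _ => T.nodup j, ?_⟩
  have hdirs : (dirArc i k).Nodup := by interval_cases k <;> decide +revert
  refine hdirs.imp fun hij s hi hj => hij ?_
  exact eq_of_mem_frameSection T.lt (T.mem _ _ hi) (T.mem _ _ hj)

theorem exchange (j : Dir) {v w : Square} (h : w = frameShift m n j + v) :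
    translate w (arc a j 2) = (translate v (arc a (j + 4) 2)).reverse := by
  rw [h, ← translate_translate, T.shift, translate_reverse]

open scoped Fin.CommRing in
theorem tight_arc {k : ℕ} (hk : 2 ≤ k) (hk' : k ≤ 7) : ∀ i, Tight (IsLeap 0 1) (arc a i k) := by
  induction k, hk using Nat.le_induction with
  | base => exact T.tight
  | succ k hk ih =>
    intro i
    obtain ⟨k, rfl⟩ := Nat.exists_eq_add_of_le' (one_le_two.trans hk)
    have hAB := ih (by omega) i
    have hBC := ih (by omega) (i + 1)
    rw [arc_succ] at hAB ⊢
    rw [arc_add, arc_one] at hBC ⊢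
    rw [← List.append_assoc]
    refine hAB.glue hBC fun u hu v hv huv => ?_
    have hdir := eq_or_eq_add_one_or_eq_sub_one_of_isLeap T.lt (T.mem _ _ hu) (T.mem _ _ hv) huv
    have hk₀ : 1 ≤ k := by omega
    have hk₅ : k ≤ 5 := by omega
    clear hAB hBC hu hv ih
    interval_cases k <;> revert hdir <;> decide +revert

theorem spaced_arc {d p q k : ℕ} (hd : d ≤ x + y) (h : ∀ i, Spaced d (IsLeap p q) (arc a i 3))
    (hk : 3 ≤ k) : ∀ i, Spaced d (IsLeap p q) (arc a i k) := by
  induction k, hk using Nat.le_induction with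
  | base => exact h
  | succ k hk ih =>
    intro i
    obtain ⟨k, rfl⟩ := Nat.exists_eq_add_of_le' (one_le_two.trans (Nat.le_of_succ_le hk))
    have hAB := ih i
    have hBC := ih (i + 1)
    rw [arc_succ] at hAB ⊢
    rw [arc_add, arc_one] at hBC ⊢
    rw [← List.append_assoc]
    exact hAB.glue (hd.trans (T.le_length_arc (by omega) _)) hBC

end IsTrack

section path
variable {m n : ℕ} {a : Dir → List Square} {t : Lifting} {i : Dir}

theorem mem_path {s : Square} :
    s ∈ t.path m n a i ↔ ∃ j ∈ t.sources i, s - t.shift m n i ∈ a j := by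
  rw [Lifting.path, mem_translate]
  split_ifs <;> simp only [List.mem_reverse, List.mem_flatMap]

open scoped Fin.CommRing in
theorem path_of_isShort (hi : t.IsShort i) : t.path m n a i =
    translate (t.shift m n i) (arc a (i - t.radius) (2 * t.radius + 1)) := by
  rw [Lifting.path, if_pos hi, Lifting.sources, if_pos hi, arc]

open scoped Fin.CommRing in
theorem path_of_not_isShort (hi : ¬ t.IsShort i) : t.path m n a i =
    (translate (t.shift m n i) (arc a (i + 3 - t.radius) (2 * t.radius + 3))).reverse := by
  rw [Lifting.path, if_neg hi, Lifting.sources, if_neg hi, ← arc, translate_reverse]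

theorem Lifting.isShort_add_one_iff : t.IsShort (i + 1) ↔ ¬ t.IsShort i := by
  cases t <;> decide +revert

theorem Lifting.isShort_sub_one_iff : t.IsShort (i - 1) ↔ ¬ t.IsShort i := by
  cases t <;> decide +revert

theorem Lifting.isShort_add_four_iff : t.IsShort (i + 4) ↔ t.IsShort i := by
  cases t <;> decide +revert

namespace IsTrack
variable {x y : ℕ} (T : IsTrack m n x y a)
include T

open scoped Fin.CommRing in
theorem path_add_one (hi : t.IsShort i) : t.path m n a (i + 1) =
    translate (t.shift m n i) (arc a (i + t.radius + 1) 2) ++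
      (translate (t.shift m n (i + 1))
        (arc a (i + 4 - t.radius) (2 * t.radius + 1))).reverse := by
  have hdir₁ : i + 4 - (t.radius : Fin 8) + (2 * t.radius + 1 : ℕ) = i + t.radius + 5 := by
    push_cast; ring
  have hdir₂ : i + 4 - (t.radius : Fin 8) = i + 1 + 3 - t.radius := by ring
  have hdir₃ : i + t.radius + 1 = i + t.radius + 5 + 4 := by grind
  rw [path_of_not_isShort (by rwa [Lifting.isShort_add_one_iff, not_not]), ← hdir₂, hdir₃,
    show 2 * t.radius + 3 = 2 * t.radius + 1 + 2 from rfl, arc_add, translate_append,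
    List.reverse_append, hdir₁, T.exchange _ (t.shift_add_one hi), List.reverse_reverse]

open scoped Fin.CommRing in
theorem path_sub_one (hi : t.IsShort i) : t.path m n a (i - 1) =
    (translate (t.shift m n (i - 1)) (arc a (i + 4 - t.radius) (2 * t.radius + 1))).reverse ++
      translate (t.shift m n i) (arc a (i - t.radius - 2) 2) := by
  have hdir₁ : i - 1 + 3 - (t.radius : Fin 8) = i - t.radius + 2 := by ring
  have hdir₂ : i - t.radius + 2 + (2 : ℕ) = i + 4 - (t.radius : Fin 8) := by push_cast; ring
  have hdir₃ : i - t.radius - 2 = i - t.radius + 2 + 4 := by grind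
  rw [path_of_not_isShort (by rwa [Lifting.isShort_sub_one_iff, not_not]), hdir₁, hdir₃,
    show 2 * t.radius + 3 = 2 + (2 * t.radius + 1) by omega, arc_add, translate_append,
    List.reverse_append, hdir₂, T.exchange _ (t.shift_sub_one hi), List.reverse_reverse]

end IsTrack
end path

/-- The length of the paths of the lifted track in the sections to the sides and at the corners of
the hole, in terms of those of the original one. -/
def Lifting.lengths : Lifting → ℕ × ℕ → ℕ × ℕ
  | .f, (x, y) => (x + 2 * y, y)
  | .g, (x, y) => (x, 2 * x + y)
  | .h, (x, y) => (3 * x + 2 * y, 2 * x + y)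

open scoped Fin.CommRing in
theorem frameShift_add_four (m n : ℕ) (i : Dir) : frameShift m n (i + 4) = -frameShift m n i := by
  fin_cases i <;> simp [frameShift]

theorem Lifting.shift_add_one_add_frameShift (t : Lifting) {m n : ℕ} (hmn : m < n) (i : Dir) :
    t.shift m n (i + 1) + frameShift (t.target (m, n)).1 (t.target (m, n)).2 i =
      t.shift m n (i + 4) := by
  have h := t.shift_add_frameShift hmn (i + 4)
  rw [frameShift_add_four, ← sub_eq_add_neg, sub_eq_iff_eq_add] at h
  rw [h, show i + 4 + 5 = i + 1 by grind]

theorem Lifting.target_fst_lt_snd (t : Lifting) {m n : ℕ} (hm : 0 < m) (hmn : m < n) :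
    0 < (t.target (m, n)).1 ∧ (t.target (m, n)).1 < (t.target (m, n)).2 := by
  cases t <;> simp only [target] <;> omega

section arc
variable {α : Type*} (a : Dir → List α) (i : Dir) (r : ℕ)

open scoped Fin.CommRing in
theorem arc_centered_append : arc a (i - r) (2 * r + 1) ++ arc a (i + r + 1) 2 =
    arc a (i - r) (2 * r + 3) := by
  have hdir : i - (r : Fin 8) + (2 * r + 1 : ℕ) = i + r + 1 := by push_cast; ring
  rw [show 2 * r + 3 = 2 * r + 1 + 2 from rfl, arc_add a _ (2 * r + 1), hdir]

open scoped Fin.CommRing in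
theorem append_arc_centered : arc a (i - r - 2) 2 ++ arc a (i - r) (2 * r + 1) =
    arc a (i - r - 2) (2 * r + 3) := by
  have hdir : i - (r : Fin 8) - 2 + (2 : ℕ) = i - r := by push_cast; ring
  rw [show 2 * r + 3 = 2 + (2 * r + 1) by omega, arc_add a _ 2, hdir]

open scoped Fin.CommRing in
theorem append_arc_centered_append :
    arc a (i - r - 2) 2 ++ arc a (i - r) (2 * r + 1) ++ arc a (i + r + 1) 2 =
      arc a (i - r - 2) (2 * r + 5) := by
  have hdir : i - (r : Fin 8) - 2 + (2 * r + 3 : ℕ) = i + r + 1 := by push_cast; ring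
  rw [append_arc_centered, show 2 * r + 5 = 2 * r + 3 + 2 from rfl, arc_add a _ (2 * r + 3), hdir]

end arc

namespace IsTrack
variable {m n x y : ℕ} {a : Dir → List Square} (T : IsTrack m n x y a) {t : Lifting} {i : Dir}
include T

open scoped Fin.CommRing in
theorem path_append_path_of_isShort (hi : t.IsShort i) :
    t.path m n a i ++ t.path m n a (i + 1) =
      translate (t.shift m n i) (arc a (i - t.radius) (2 * t.radius + 3)) ++
        (translate (t.shift m n (i + 1))
          (arc a (i + 4 - t.radius) (2 * t.radius + 1))).reverse := by
  rw [path_of_isShort hi, T.path_add_one hi, ← List.append_assoc, ← translate_append,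
    arc_centered_append]

open scoped Fin.CommRing in
theorem path_append_path_of_isShort_succ (hi : t.IsShort i) :
    t.path m n a (i - 1) ++ t.path m n a i =
      (translate (t.shift m n (i - 1)) (arc a (i + 4 - t.radius) (2 * t.radius + 1))).reverse ++
        translate (t.shift m n i) (arc a (i - t.radius - 2) (2 * t.radius + 3)) := by
  rw [path_of_isShort hi, T.path_sub_one hi, List.append_assoc, ← translate_append,
    append_arc_centered]

end IsTrack

theorem Lifting.isShort_induction (t : Lifting) {P : Dir → Prop} (h : ∀ i, t.IsShort i → P i)
    (h' : ∀ i, t.IsShort i → P (i - 1)) (i : Dir) : P i := by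
  by_cases hi : t.IsShort i
  · exact h i hi
  · exact add_sub_cancel_right i 1 ▸ h' (i + 1) (isShort_add_one_iff.2 hi)

namespace IsTrack
variable {m n x y : ℕ} {a : Dir → List Square} (T : IsTrack m n x y a) {t : Lifting} {i : Dir}
include T

theorem mem_lift (i : Dir) (s : Square) (hs : s ∈ t.path m n a i) :
    s ∈ frameSection (t.target (m, n)).1 (t.target (m, n)).2 i := by
  obtain ⟨j, hj, hs⟩ := mem_path.1 hs
  rw [← t.add_shift_mem_frameSection_iff T.pos T.lt (T.mem j _ hs), sub_add_cancel] at hj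
  exact hj

theorem nodup_lift (i : Dir) : (t.path m n a i).Nodup := by
  have hr : 2 * t.radius + 3 ≤ 8 := by cases t <;> decide
  by_cases hi : t.IsShort i
  · rw [path_of_isShort hi]
    exact (T.nodup_arc (by omega) _).map (add_left_injective _)
  · rw [path_of_not_isShort hi, List.nodup_reverse]
    exact (T.nodup_arc hr _).map (add_left_injective _)

theorem length_lift (i : Dir) : (t.path m n a i).length =
    if i.val % 2 = 0 then (t.lengths (x, y)).1 else (t.lengths (x, y)).2 := by
  have h : (t.path m n a i).length = ((t.sources i).map fun j => (a j).length).sum := by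
    rw [Lifting.path, length_translate]
    split_ifs <;> simp only [List.length_reverse, List.length_flatMap]
  rw [h]
  simp only [T.length_eq]
  cases t <;> fin_cases i <;>
    simp [Lifting.sources, Lifting.IsShort, Lifting.radius, dirArc, Lifting.lengths] <;> ring

open scoped Fin.CommRing in
theorem shift_lift (i : Dir) :
    translate (frameShift (t.target (m, n)).1 (t.target (m, n)).2 i) (arc (t.path m n a) i 2) =
      (arc (t.path m n a) (i + 4) 2).reverse := by
  have hs := t.shift_add_frameShift T.lt
  have hs' := t.shift_add_one_add_frameShift T.lt
  simp only [arc_two]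
  induction i using t.isShort_induction with
  | h i hi =>
    have hi₄ : t.IsShort (i + 4) := Lifting.isShort_add_four_iff.2 hi
    have hi₅ : ¬ t.IsShort (i + 4 + 1) := by rwa [Lifting.isShort_add_one_iff, not_not]
    have hdir₁ : i + 4 + 1 = i + 5 := by ring
    have hdir₂ : i + 5 + 3 - (t.radius : Fin 8) = i - t.radius := by grind
    rw [T.path_append_path_of_isShort hi, path_of_isShort hi₄, path_of_not_isShort hi₅,
      translate_append, translate_reverse, translate_translate, translate_translate, hs, hs',
      List.reverse_append, List.reverse_reverse, hdir₁, hdir₂]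
  | h' i hi =>
    have hi₄ : t.IsShort (i - 1 + 5) := by
      rwa [show i - 1 + 5 = i + 4 by ring, Lifting.isShort_add_four_iff]
    have hi₃ : ¬ t.IsShort (i - 1 + 4) := by
      rwa [Lifting.isShort_add_four_iff, Lifting.isShort_sub_one_iff, not_not]
    have hs'' := hs' (i - 1)
    have hdir₁ : i - 1 + 4 + 1 = i - 1 + 5 := by ring
    have hdir₂ : i - 1 + 5 = i + 4 := by ring
    have hdir₃ : i - 1 + 4 + 3 - (t.radius : Fin 8) = i - t.radius - 2 := by grind
    rw [sub_add_cancel] at hs'' ⊢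
    rw [T.path_append_path_of_isShort_succ hi, hdir₁, path_of_isShort hi₄, path_of_not_isShort hi₃,
      translate_append, translate_reverse, translate_translate, translate_translate, hs, hs'',
      List.reverse_append, List.reverse_reverse, hdir₂, hdir₃]

theorem not_isLeap_of_mem_path {k : Dir} {u v : Square} (hi : t.IsShort i)
    (hk : k = i + 1 ∨ k = i - 1) (hu : u ∈ t.path m n a i)
    (hv : v ∈ translate (t.shift m n k) ((t.sources (i + 4)).flatMap a)) : ¬ IsLeap 0 1 u v := by
  obtain ⟨j, hj, hv⟩ := List.mem_flatMap.1 (mem_translate.1 hv)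
  exact sub_add_cancel v _ ▸ t.not_isLeap T.lt hi hj hk (T.mem_lift i u hu) (T.mem j _ hv)

open scoped Fin.CommRing in
theorem tight_lift (i : Dir) : Tight (IsLeap 0 1) (arc (t.path m n a) i 2) := by
  have tight_centered (j : Dir) : Tight (IsLeap 0 1) (arc a j (2 * t.radius + 3)) := by
    refine T.tight_arc ?_ ?_ j <;> cases t <;> decide
  have tight_long {k : Dir} (hk : ¬ t.IsShort k) : Tight (IsLeap 0 1) (t.path m n a k) :=
    path_of_not_isShort hk ▸ ((tight_centered _).translate _).reverse
  simp only [arc_two]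
  induction i using t.isShort_induction with
  | h i hi =>
    have hAB := (tight_centered (i - t.radius)).translate (t.shift m n i)
    have hBC := tight_long (Lifting.isShort_add_one_iff.not.2 (not_not.2 hi))
    rw [← arc_centered_append, translate_append] at hAB
    rw [T.path_add_one hi] at hBC ⊢
    rw [path_of_isShort hi, ← List.append_assoc]
    refine hAB.glue hBC fun u hu v hv => T.not_isLeap_of_mem_path hi (.inl rfl) ?_ ?_
    · rwa [path_of_isShort hi]
    · rw [Lifting.sources, if_pos (Lifting.isShort_add_four_iff.2 hi)]
      exact List.mem_reverse.1 hv
  | h' i hi =>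
    have hBC := (tight_centered (i - t.radius - 2)).translate (t.shift m n i)
    have hAB := tight_long (Lifting.isShort_sub_one_iff.not.2 (not_not.2 hi))
    rw [← append_arc_centered, translate_append] at hBC
    rw [T.path_sub_one hi] at hAB ⊢
    rw [sub_add_cancel, path_of_isShort hi]
    refine hAB.glue hBC fun u hu v hv huv =>
      T.not_isLeap_of_mem_path hi (.inr rfl) ?_ ?_ (Std.Symm.symm u v huv)
    · rwa [path_of_isShort hi]
    · rw [Lifting.sources, if_pos (Lifting.isShort_add_four_iff.2 hi)]
      exact List.mem_reverse.1 hu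

protected theorem lift (t : Lifting) :
    IsTrack (t.target (m, n)).1 (t.target (m, n)).2 (t.lengths (x, y)).1 (t.lengths (x, y)).2
      (t.path m n a) where
  pos := (t.target_fst_lt_snd T.pos T.lt).1
  lt := (t.target_fst_lt_snd T.pos T.lt).2
  pos_x := by
    have := T.pos_x
    cases t <;> simp only [Lifting.lengths] <;> omega
  pos_y := by
    have := T.pos_y
    cases t <;> simp only [Lifting.lengths] <;> omega
  length_eq := T.length_lift
  mem := T.mem_lift
  nodup := T.nodup_lift
  shift := T.shift_lift
  tight := T.tight_lift

open scoped Fin.CommRing in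
theorem spaced_triple_of_isShort {d p q : ℕ} (hd : d ≤ x + y)
    (h : ∀ i, Spaced d (IsLeap p q) (arc a i 3)) (hi : t.IsShort i) :
    Spaced d (IsLeap p q) (t.path m n a (i - 1) ++ t.path m n a i ++ t.path m n a (i + 1)) := by
  have spaced_long {j : Dir} (hj : ¬ t.IsShort j) : Spaced d (IsLeap p q) (t.path m n a j) :=
    path_of_not_isShort hj ▸ ((T.spaced_arc hd h (by omega) _).translate _).reverse
  have hprev := spaced_long (Lifting.isShort_sub_one_iff.not.2 (not_not.2 hi))
  have hnext := spaced_long (Lifting.isShort_add_one_iff.not.2 (not_not.2 hi))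
  have hmid := (T.spaced_arc hd h (k := 2 * t.radius + 5) (by omega) (i - t.radius - 2)).translate
    (t.shift m n i)
  have hlen (j : Dir) : d ≤ (translate (t.shift m n i) (arc a j 2)).length := by
    rwa [length_translate, T.length_arc_two]
  rw [← append_arc_centered_append, translate_append, translate_append] at hmid
  rw [T.path_sub_one hi] at hprev ⊢
  rw [T.path_add_one hi] at hnext ⊢
  rw [path_of_isShort hi, ← List.append_assoc]
  refine Spaced.glue (hlen _) ?_ hnext
  rw [List.append_assoc] at hmid ⊢
  exact hprev.glue (hlen _) hmid

theorem spaced_lift {d p q : ℕ} (hd : d ≤ x + y) (h : ∀ i, Spaced d (IsLeap p q) (arc a i 3))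
    (i : Dir) : Spaced d (IsLeap p q) (arc (t.path m n a) i 3) := by
  have triple {i : Dir} := T.spaced_triple_of_isShort (t := t) (i := i) hd h
  rw [arc_succ, arc_two, ← List.append_assoc]
  induction i using t.isShort_induction with
  | h i hi =>
    have hlen : d ≤ (t.path m n a (i + 1)).length := by
      rw [T.path_add_one hi, List.length_append, length_translate, T.length_arc_two]
      exact Nat.le_add_right_of_le hd
    have hi₂ : t.IsShort (i + 1 + 1) := by
      rwa [Lifting.isShort_add_one_iff, Lifting.isShort_add_one_iff, not_not]
    have hnext := triple hi₂
    rw [add_sub_cancel_right] at hnext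
    refine Spaced.glue hlen ?_ (hnext.of_infix List.infix_append_left)
    exact (triple hi).of_infix (by rw [List.append_assoc]; exact List.infix_append_right)
  | h' i hi =>
    rw [sub_add_cancel]
    exact triple hi

end IsTrack

/-! ### Components of the leaper graph -/

/-- The squares `u` and `v` lie in the same component of the leaper graph over `S`. -/
def Joined (p q : ℕ) (S : Set Square) (u v : Square) : Prop :=
  ∃ (hu : u ∈ S) (hv : v ∈ S), (leaperGraphOn p q S).Reachable ⟨u, hu⟩ ⟨v, hv⟩

theorem leaperGraphOn_adj_iff {p q : ℕ} {S : Set Square} (hp : 0 < p ∨ 0 < q) {u v : S} :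
    (leaperGraphOn p q S).Adj u v ↔ IsLeap p q u v := by
  refine ⟨fun h => h.2, fun h => ⟨fun huv => ?_, h⟩⟩
  rw [IsLeap, show (u : Square) = v from huv, sub_self] at h
  simp only [IsMove, Prod.fst_zero, Prod.snd_zero, Int.natAbs_zero] at h
  omega

namespace Joined
variable {p q : ℕ} {S : Set Square} {u v w : Square}

theorem refl (hu : u ∈ S) : Joined p q S u u := ⟨hu, hu, .rfl⟩

theorem symm : Joined p q S u v → Joined p q S v u := fun ⟨hu, hv, h⟩ => ⟨hv, hu, h.symm⟩

theorem trans : Joined p q S u v → Joined p q S v w → Joined p q S u w :=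
  fun ⟨hu, _, h⟩ ⟨_, hw, h'⟩ => ⟨hu, hw, h.trans h'⟩

theorem of_isLeap (hp : 0 < p ∨ 0 < q) (hu : u ∈ S) (hv : v ∈ S) (h : IsLeap p q u v) :
    Joined p q S u v :=
  ⟨hu, hv, SimpleGraph.Adj.reachable ((leaperGraphOn_adj_iff hp).2 h)⟩

theorem induction {R : Square → Square → Prop} (hrefl : ∀ u ∈ S, R u u)
    (hstep : ∀ u ∈ S, ∀ v ∈ S, ∀ w ∈ S, IsLeap p q u v → R v w → R u w)
    (h : Joined p q S u v) : R u v := by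
  obtain ⟨hu, hv, ⟨c⟩⟩ := h
  suffices ∀ u v : S, (leaperGraphOn p q S).Walk u v → R u v from this _ _ c
  intro u v c
  induction c with
  | nil => exact hrefl _ (Subtype.prop _)
  | cons h _ ih => exact hstep _ (Subtype.prop _) _ (Subtype.prop _) _ (Subtype.prop _) h.2 ih

end Joined

theorem isMove_frameShift (m n : ℕ) (i : Dir) : IsMove m n (frameShift m n i) := by
  fin_cases i <;> simp [IsMove, frameShift]

theorem isLeap_add_frameShift (m n : ℕ) (i : Dir) (u : Square) :
    IsLeap m n u (u + frameShift m n i) := by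
  rw [IsLeap, add_sub_cancel_left]
  exact isMove_frameShift m n i

/-- The squares of a system of paths. -/
def trackSet (a : Dir → List Square) : Set Square := {s | ∃ i, s ∈ a i}

namespace Lifting
variable (t : Lifting)

-- The translations towards `i` and `i + 5` differ by a leaper move of the target frame. Hence the
-- translates of section `j` are joined along a run of such directions.
open scoped Fin.CommRing in
theorem exists_run_sources {i j k : Dir} (hi : j ∈ t.sources i) (hk : j ∈ t.sources k) :
    ∃ s < 5, (k = i + 5 * (s : ℕ) ∧ ∀ r ≤ s, j ∈ t.sources (i + 5 * (r : ℕ))) ∨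
      (i = k + 5 * (s : ℕ) ∧ ∀ r ≤ s, j ∈ t.sources (k + 5 * (r : ℕ))) := by
  cases t <;> decide +revert

open scoped Fin.CommRing in
theorem exists_isShort_eq (s : Dir) :
    ∃ j, t.IsShort j ∧ (s = j + t.radius + 5 ∨ s = j - t.radius + 2) := by
  cases t <;> decide +revert

-- Each move of the smaller leaper remains a move of the larger one between suitable translates.
open scoped Fin.CommRing in
theorem exists_shift_eq_frameShift (s : Dir) :
    ∃ i k, (s ∈ t.sources i ∧ s + 1 ∈ t.sources i) ∧
      (s + 4 ∈ t.sources (i + 4) ∧ s + 5 ∈ t.sources (i + 4)) ∧ ∀ {m n : ℕ}, m < n →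
        frameShift m n s + t.shift m n (i + 4) =
          t.shift m n i + frameShift (t.target (m, n)).1 (t.target (m, n)).2 k := by
  obtain ⟨j, hj, rfl | rfl⟩ := t.exists_isShort_eq s
  · refine ⟨j + 1, j, ?_, ?_, fun {m n} hmn => ?_⟩
    · cases t <;> decide +revert
    · cases t <;> decide +revert
    · rw [show j + 1 + 4 = j + 5 by ring, ← t.shift_add_frameShift hmn, t.shift_add_one hj]
      exact (add_assoc _ _ _).symm
  · refine ⟨j - 1, j - 1, ?_, ?_, fun {m n} hmn => ?_⟩
    · cases t <;> decide +revert
    · cases t <;> decide +revert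
    · rw [t.shift_sub_one hj, add_assoc, ← t.shift_add_one_add_frameShift hmn (j - 1),
        sub_add_cancel]

theorem add_shift_mem_trackSet {m n : ℕ} {a : Dir → List Square} {i j : Dir} {c : Square}
    (hj : j ∈ t.sources i) (hc : c ∈ a j) :
    c + t.shift m n i ∈ trackSet (t.path m n a) :=
  ⟨i, mem_path.2 ⟨j, hj, by rwa [add_sub_cancel_right]⟩⟩

end Lifting

namespace IsTrack
variable {m n x y : ℕ} {a : Dir → List Square} (T : IsTrack m n x y a) (t : Lifting)
include T

theorem add_frameShift_mem {s : Dir} {c : Square} (hc : c ∈ a s ∨ c ∈ a (s + 1)) :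
    c + frameShift m n s ∈ a (s + 4) ∨ c + frameShift m n s ∈ a (s + 5) := by
  have : c + frameShift m n s ∈ translate (frameShift m n s) (arc a s 2) := by
    rwa [mem_translate, add_sub_cancel_right, arc_two, List.mem_append]
  rwa [T.shift, List.mem_reverse, arc_two, List.mem_append, add_assoc] at this

theorem lift_trackSet : t.lift m n (trackSet a) = trackSet (t.path m n a) := by
  ext b
  simp only [Lifting.lift, trackSet, Set.mem_ofPred_eq]
  refine exists_congr fun i => ⟨fun ⟨hb, j, hj⟩ => ?_, fun hb => ⟨T.mem_lift i b hb, ?_⟩⟩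
  · rw [← sub_add_cancel b, t.add_shift_mem_frameSection_iff T.pos T.lt (T.mem _ _ hj)] at hb
    exact mem_path.2 ⟨j, hb, hj⟩
  · obtain ⟨j, -, hj⟩ := mem_path.1 hb
    exact ⟨j, hj⟩

open scoped Fin.CommRing in
theorem joined_lift_lift {i j k : Dir} {c : Square} (hi : j ∈ t.sources i) (hk : j ∈ t.sources k)
    (hc : c ∈ a j) : Joined (t.target (m, n)).1 (t.target (m, n)).2 (trackSet (t.path m n a))
      (c + t.shift m n i) (c + t.shift m n k) := by
  have hpos := (t.target_fst_lt_snd T.pos T.lt).1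
  have joined_run (s : ℕ) (i : Dir) (h : ∀ r ≤ s, j ∈ t.sources (i + 5 * (r : ℕ))) :
      Joined (t.target (m, n)).1 (t.target (m, n)).2 (trackSet (t.path m n a))
        (c + t.shift m n i) (c + t.shift m n (i + 5 * (s : ℕ))) := by
    induction s with
    | zero => simpa using Joined.refl (t.add_shift_mem_trackSet (h 0 le_rfl) hc)
    | succ s ih =>
      refine (ih fun r hr => h r (by omega)).trans (.of_isLeap (.inl hpos)
        (t.add_shift_mem_trackSet (h s (by omega)) hc)
        (t.add_shift_mem_trackSet (h _ le_rfl) hc) ?_)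
      rw [Nat.cast_succ, mul_add, mul_one, ← add_assoc, ← t.shift_add_frameShift T.lt, ← add_assoc]
      exact isLeap_add_frameShift _ _ _ _
  obtain ⟨s, -, ⟨rfl, h⟩ | ⟨rfl, h⟩⟩ := t.exists_run_sources hi hk
  · exact joined_run s i h
  · exact (joined_run s k h).symm

theorem joined_lift_of_isLeap {i j k l : Dir} {c d : Square} (hj : j ∈ t.sources i) (hc : c ∈ a j)
    (hl : l ∈ t.sources k) (hd : d ∈ a l) (h : IsLeap m n c d) :
    Joined (t.target (m, n)).1 (t.target (m, n)).2 (trackSet (t.path m n a))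
      (c + t.shift m n i) (d + t.shift m n k) := by
  obtain ⟨s, hs, rfl⟩ : ∃ s, (c ∈ a s ∨ c ∈ a (s + 1)) ∧ d = c + frameShift m n s := by
    rcases eq_add_frameShift_of_isLeap T.pos T.lt (T.mem _ _ hc)
      (frameSection_subset_board _ (T.mem _ _ hd)) h with hd | hd
    · exact ⟨_, .inl hc, hd⟩
    · exact ⟨_, .inr (by rwa [sub_add_cancel]), hd⟩
  obtain ⟨i', k', hi', hk', hshift⟩ := t.exists_shift_eq_frameShift s
  obtain ⟨j', hj', hcj'⟩ : ∃ j' ∈ t.sources i', c ∈ a j' :=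
    hs.elim (⟨_, hi'.1, ·⟩) (⟨_, hi'.2, ·⟩)
  obtain ⟨l', hl', hdl'⟩ : ∃ l' ∈ t.sources (i' + 4), c + frameShift m n s ∈ a l' :=
    (T.add_frameShift_mem hs).elim (⟨_, hk'.1, ·⟩) (⟨_, hk'.2, ·⟩)
  obtain rfl : j = j' := eq_of_mem_frameSection T.lt (T.mem _ _ hc) (T.mem _ _ hcj')
  obtain rfl : l = l' := eq_of_mem_frameSection T.lt (T.mem _ _ hd) (T.mem _ _ hdl')
  refine (T.joined_lift_lift t hj hj' hc).trans (.trans (.of_isLeap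
    (.inl (t.target_fst_lt_snd T.pos T.lt).1) (t.add_shift_mem_trackSet hj' hc)
    (t.add_shift_mem_trackSet hl' hd) ?_) (T.joined_lift_lift t hl' hl hd))
  rw [add_assoc, hshift T.lt, ← add_assoc]
  exact isLeap_add_frameShift _ _ _ _

theorem joined_lift_of_joined {c d : Square} (h : Joined m n (trackSet a) c d) :
    ∀ i j k l, j ∈ t.sources i → c ∈ a j → l ∈ t.sources k → d ∈ a l →
      Joined (t.target (m, n)).1 (t.target (m, n)).2 (trackSet (t.path m n a))
        (c + t.shift m n i) (d + t.shift m n k) := by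
  refine h.induction (R := fun c d => ∀ i j k l, j ∈ t.sources i → c ∈ a j → l ∈ t.sources k →
    d ∈ a l → Joined _ _ _ (c + t.shift m n i) (d + t.shift m n k)) ?_ ?_
  · intro c _ i j k l hj hc hl hc'
    obtain rfl : j = l := eq_of_mem_frameSection T.lt (T.mem _ _ hc) (T.mem _ _ hc')
    exact T.joined_lift_lift t hj hl hc
  · rintro c - d ⟨s, hd⟩ e - hcd ih i j k l hj hc hl he
    obtain ⟨r, -, ⟨hs, -⟩, -⟩ := t.exists_shift_eq_frameShift s
    exact (T.joined_lift_of_isLeap t hj hc hs hd hcd).trans (ih r s k l hs hd hl he)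

theorem joined_lift (h : ∀ c ∈ trackSet a, ∀ d ∈ trackSet a, Joined m n (trackSet a) c d) :
    ∀ c ∈ trackSet (t.path m n a), ∀ d ∈ trackSet (t.path m n a),
      Joined (t.target (m, n)).1 (t.target (m, n)).2 (trackSet (t.path m n a)) c d := by
  rintro c ⟨i, hc⟩ d ⟨k, hd⟩
  obtain ⟨j, hj, hc⟩ := mem_path.1 hc
  obtain ⟨l, hl, hd⟩ := mem_path.1 hd
  simpa using T.joined_lift_of_joined t (h _ ⟨j, hc⟩ _ ⟨l, hd⟩) i j k l hj hc hl hd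

end IsTrack

theorem exists_isHamiltonianCycle_of_ncard_neighborSet_eq_two {V : Type*} [Finite V]
    [DecidableEq V] {G : SimpleGraph V} (hG : G.Connected)
    (h : ∀ v, (G.neighborSet v).ncard = 2) :
    ∃ (v : V) (w : G.Walk v v), w.IsHamiltonianCycle := by
  obtain ⟨v⟩ := hG.nonempty
  have hcyc : G.IsCycles := fun v _ => h v
  obtain ⟨w, hw, hverts⟩ := hcyc.exists_cycle_toSubgraph_verts_eq_connectedComponentSupp
    (v := v) (c := G.connectedComponentMk v) rfl
    (Set.nonempty_of_ncard_ne_zero (by rw [h]; decide))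
  refine ⟨v, w, hw, hw.isPath_tail.isHamiltonian_of_mem fun u => ?_⟩
  have hu : u ∈ w.support := by
    rw [← SimpleGraph.Walk.mem_verts_toSubgraph, hverts]
    exact SimpleGraph.ConnectedComponent.sound (hG.preconnected u v)
  rw [SimpleGraph.Walk.support_tail_of_not_nil _ hw.not_nil]
  rcases (SimpleGraph.Walk.mem_support_iff w).1 hu with rfl | hu
  · exact SimpleGraph.Walk.end_mem_tail_support hw.not_nil
  · exact hu

theorem frameShift_ne_frameShift_sub_one {m n : ℕ} (hm : 0 < m) (hmn : m < n) (i : Dir) :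
    frameShift m n i ≠ frameShift m n (i - 1) := by
  fin_cases i <;> simp [frameShift, Prod.ext_iff] <;> omega

theorem finite_trackSet (a : Dir → List Square) : (trackSet a).Finite := by
  have : trackSet a = ⋃ i, {s | s ∈ a i} := by ext; simp [trackSet]
  rw [this]
  exact Set.finite_iUnion fun i => List.finite_toSet _

theorem preconnected_of_joined {p q : ℕ} {S : Set Square}
    (h : ∀ c ∈ S, ∀ d ∈ S, Joined p q S c d) : (leaperGraphOn p q S).Preconnected :=
  fun c d => (h c c.2 d d.2).2.2

namespace IsTrack
variable {m n x y : ℕ} {a : Dir → List Square} (T : IsTrack m n x y a)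
include T

theorem ncard_neighborSet (u : trackSet a) :
    ((leaperGraphOn m n (trackSet a)).neighborSet u).ncard = 2 := by
  obtain ⟨c, j, hc⟩ := u
  have hnext : c + frameShift m n j ∈ trackSet a :=
    (T.add_frameShift_mem (.inl hc)).elim (⟨_, ·⟩) (⟨_, ·⟩)
  have hprev : c + frameShift m n (j - 1) ∈ trackSet a :=
    (T.add_frameShift_mem (.inr (by rwa [sub_add_cancel]))).elim (⟨_, ·⟩) (⟨_, ·⟩)
  rw [Set.ncard_eq_two]
  refine ⟨⟨_, hnext⟩, ⟨_, hprev⟩, ?_, ?_⟩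
  · simpa using frameShift_ne_frameShift_sub_one T.pos T.lt j
  · ext ⟨d, k, hd⟩
    simp only [SimpleGraph.mem_neighborSet, leaperGraphOn_adj_iff (.inl T.pos),
      Set.mem_insert_iff, Set.mem_singleton_iff, Subtype.ext_iff]
    refine ⟨eq_add_frameShift_of_isLeap T.pos T.lt (T.mem _ _ hc)
      (frameSection_subset_board _ (T.mem _ _ hd)), ?_⟩
    rintro (rfl | rfl) <;> exact isLeap_add_frameShift _ _ _ _

theorem isToured (h : ∀ c ∈ trackSet a, ∀ d ∈ trackSet a, Joined m n (trackSet a) c d) :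
    IsToured m n (trackSet a) := by
  have := (finite_trackSet a).to_subtype
  obtain ⟨c, hc⟩ := List.exists_mem_of_ne_nil _ (T.ne_nil 0)
  have hconn : (leaperGraphOn m n (trackSet a)).Connected :=
    { preconnected := preconnected_of_joined h, nonempty := ⟨⟨c, 0, hc⟩⟩ }
  exact exists_isHamiltonianCycle_of_ncard_neighborSet_eq_two hconn T.ncard_neighborSet

theorem isCycleSet (h : ∀ c ∈ trackSet a, ∀ d ∈ trackSet a, Joined m n (trackSet a) c d) :
    IsCycleSet m n (trackSet a) :=
  ⟨fun _ ⟨i, hs⟩ => frameSection_subset_board i (T.mem i _ hs), T.isToured h⟩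

end IsTrack

/-! ### Hamiltonian cycles indexed by residues -/

section walks
variable {V : Type*} {G : SimpleGraph V}

theorem exists_walk_of_adj_succ (f : ℕ → V) (N : ℕ) (h : ∀ i < N, G.Adj (f i) (f (i + 1))) :
    ∃ w : G.Walk (f 0) (f N), w.length = N ∧ ∀ i ≤ N, w.getVert i = f i := by
  induction N generalizing f with
  | zero => exact ⟨.nil, rfl, by simp⟩
  | succ N ih =>
    obtain ⟨w, hw, hf⟩ := ih (fun i => f (i + 1)) fun i hi => h (i + 1) (by omega)
    refine ⟨.cons (h 0 (by omega)) w, by simp [hw], fun i hi => ?_⟩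
    cases i with
    | zero => simp
    | succ i => rw [SimpleGraph.Walk.getVert_cons_succ, hf i (by omega)]

theorem exists_isHamiltonianCycle_of_bijective [DecidableEq V] {N : ℕ} (hN : 3 ≤ N)
    {f : ZMod N → V} (hf : f.Bijective) (hadj : ∀ i, G.Adj (f i) (f (i + 1))) {v : V}
    (hv : f 0 = v) :
    ∃ w : G.Walk v v, w.IsHamiltonianCycle ∧ w.length = N ∧ ∀ i ≤ N, w.getVert i = f i := by
  obtain ⟨w, hw, hget⟩ : ∃ w : G.Walk v v, w.length = N ∧ ∀ i ≤ N, w.getVert i = f i := by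
    obtain ⟨w, hw, hget⟩ := exists_walk_of_adj_succ (G := G) (fun i => f i) N
      fun i _ => by simpa using hadj i
    exact ⟨w.copy (by simpa using hv) (by simpa using hv), by simpa, by simpa⟩
  have hnil : ¬ w.Nil := by rw [← SimpleGraph.Walk.length_eq_zero_iff]; omega
  have hpath : w.tail.IsPath := by
    rw [← SimpleGraph.Walk.IsPath.getVert_injOn_iff]
    intro i hi j hj hij
    have htail := SimpleGraph.Walk.length_tail_add_one hnil
    simp only [Set.mem_ofPred_eq] at hi hj
    rw [SimpleGraph.Walk.getVert_tail, SimpleGraph.Walk.getVert_tail, hget _ (by omega),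
      hget _ (by omega), hf.1.eq_iff, Nat.cast_succ, Nat.cast_succ, add_left_inj,
      ZMod.natCast_eq_natCast_iff] at hij
    exact Nat.ModEq.eq_of_lt_of_lt hij (by omega) (by omega)
  refine ⟨w, ⟨SimpleGraph.Walk.isCycle_iff_isPath_tail_and_le_length.2 ⟨hpath, by omega⟩,
    hpath.isHamiltonian_of_mem fun u => ?_⟩, hw, hget⟩
  have : NeZero N := ⟨by omega⟩
  obtain ⟨i, rfl⟩ := hf.2 u
  rw [← ZMod.natCast_zmod_val i, ← hget _ i.val_lt.le,
    SimpleGraph.Walk.support_tail_of_not_nil _ hnil]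
  rcases Nat.eq_zero_or_pos i.val with h | h
  · rw [h, SimpleGraph.Walk.getVert_zero]
    exact SimpleGraph.Walk.end_mem_tail_support hnil
  · exact SimpleGraph.Walk.getVert_mem_tail_support hnil h.ne'

theorem exists_bijective_of_isHamiltonianCycle [DecidableEq V] {v : V} {w : G.Walk v v}
    (hw : w.IsHamiltonianCycle) :
    ∃ f : ZMod w.length → V, f.Bijective ∧ (∀ i, G.Adj (f i) (f (i + 1))) ∧
      ∀ i : ℕ, f i = w.getVert (i % w.length) := by
  have hN := hw.isCycle.three_le_length
  have : NeZero w.length := ⟨by omega⟩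
  refine ⟨fun i => w.getVert i.val, ⟨fun i j hij => ?_, fun u => ?_⟩, fun i => ?_,
    fun i => by simp only [ZMod.val_natCast]⟩
  · have hi := i.val_lt
    have hj := j.val_lt
    exact ZMod.val_injective _ (hw.isCycle.getVert_injOn' (by simp only [Set.mem_ofPred_eq]; omega)
      (by simp only [Set.mem_ofPred_eq]; omega) hij)
  · obtain ⟨i, rfl, hi⟩ := SimpleGraph.Walk.mem_support_iff_exists_getVert.1 (hw.mem_support u)
    refine ⟨i, ?_⟩
    rcases hi.eq_or_lt with rfl | hi
    · simp
    · simp only [ZMod.val_natCast_of_lt hi]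
  · obtain ⟨k, hk, rfl⟩ : ∃ k < w.length, (k : ZMod w.length) = i :=
      ⟨i.val, i.val_lt, ZMod.natCast_zmod_val i⟩
    have hadj := w.adj_getVert_succ hk
    simp only [← Nat.cast_succ, ZMod.val_natCast_of_lt hk]
    rcases (Nat.succ_le_of_lt hk).eq_or_lt with h | h
    · rw [Nat.succ_eq_add_one] at h ⊢
      rw [h, w.getVert_length] at hadj
      rwa [h, ZMod.natCast_self, ZMod.val_zero, w.getVert_zero]
    · rwa [ZMod.val_natCast_of_lt h]

theorem exists_isHamiltonianCycle_of_coprime [DecidableEq V] {H : SimpleGraph V} {v : V}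
    {w : G.Walk v v} (hw : w.IsHamiltonianCycle) {d : ℕ} (hd : d.Coprime w.length)
    (hadj : ∀ i, H.Adj (w.getVert (i % w.length)) (w.getVert ((i + d) % w.length))) :
    ∃ w' : H.Walk v v, w'.IsHamiltonianCycle ∧ w'.length = w.length ∧
      ∀ i ≤ w.length, w'.getVert i = w.getVert (d * i % w.length) := by
  obtain ⟨f, hf, -, hfw⟩ := exists_bijective_of_isHamiltonianCycle hw
  have hN := hw.isCycle.three_le_length
  have : NeZero w.length := ⟨by omega⟩
  have hmul : (fun i : ZMod w.length => d * i).Bijective :=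
    (ZMod.unitOfCoprime d hd).mulLeft_bijective
  have hadj' (i : ZMod w.length) : H.Adj (f (d * i)) (f (d * (i + 1))) := by
    have := hadj (d * i.val)
    rwa [← hfw, ← hfw, Nat.cast_add, Nat.cast_mul, ZMod.natCast_zmod_val, ← mul_add_one] at this
  obtain ⟨w', hw', hlen, hget⟩ := exists_isHamiltonianCycle_of_bijective hN (hf.comp hmul) hadj'
    (by simpa using hfw 0)
  refine ⟨w', hw', hlen, fun i hi => ?_⟩
  rw [hget i hi, ← hfw, Nat.cast_mul, Function.comp_apply]

end walks

section unitSteps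
variable {R : Type*} [AddCommGroupWithOne R] {σ : ℕ → R} (hne : ∀ i, σ (i + 2) ≠ σ i)
  (hstep : ∀ i, σ (i + 1) = σ i + 1 ∨ σ (i + 1) = σ i - 1)
include hne hstep

theorem eq_add_natCast_of_eq_add_one (h : σ 1 = σ 0 + 1) (i : ℕ) : σ i = σ 0 + i := by
  have forward (i : ℕ) : σ (i + 1) = σ i + 1 := by
    induction i with
    | zero => exact h
    | succ i ih =>
      refine (hstep (i + 1)).resolve_right fun hi => hne i ?_
      rw [hi, ih, add_sub_cancel_right]
  induction i with
  | zero => simp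
  | succ i ih => rw [forward, ih, Nat.cast_succ, add_assoc]

theorem eq_add_natCast_or_eq_sub_natCast :
    (∀ i : ℕ, σ i = σ 0 + i) ∨ ∀ i : ℕ, σ i = σ 0 - i := by
  refine (hstep 0).imp (eq_add_natCast_of_eq_add_one hne hstep) fun h i => ?_
  have := eq_add_natCast_of_eq_add_one (σ := fun i => - σ i) (fun i => by simpa using hne i)
    (fun i => (hstep i).symm.imp (by grind) (by grind)) (by grind) i
  grind

end unitSteps

/-- The elements of a nonempty list, indexed cyclically. -/
def cyclicGet {α : Type*} (l : List α) [NeZero l.length] (i : ZMod l.length) : α :=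
  l[i.val]'i.val_lt

section cyclicGet
variable {α : Type*} {l : List α} [NeZero l.length]

theorem cyclicGet_natCast {k : ℕ} (hk : k < l.length) : cyclicGet l k = l[k] := by
  simp only [cyclicGet, ZMod.val_natCast_of_lt hk]

theorem cyclicGet_mem (i : ZMod l.length) : cyclicGet l i ∈ l := List.getElem_mem _

theorem exists_cyclicGet_eq {u : α} (hu : u ∈ l) : ∃ i, cyclicGet l i = u := by
  obtain ⟨k, hk, rfl⟩ := List.getElem_of_mem hu
  exact ⟨k, cyclicGet_natCast hk⟩

theorem cyclicGet_injective (hl : l.Nodup) : (cyclicGet l).Injective := fun _ _ h =>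
  ZMod.val_injective _ ((hl.getElem_inj_iff).1 h)

theorem getElem?_append_self {k : ℕ} (hk : k < l.length + l.length) :
    (l ++ l)[k]? = some (cyclicGet l k) := by
  rcases lt_or_ge k l.length with h | h
  · rw [List.getElem?_append_left h, cyclicGet_natCast h, List.getElem?_eq_getElem]
  · obtain ⟨k, rfl⟩ := Nat.exists_eq_add_of_le h
    rw [List.getElem?_append_right h, Nat.add_sub_cancel_left, Nat.cast_add, ZMod.natCast_self,
      zero_add, cyclicGet_natCast (by omega), List.getElem?_eq_getElem]

theorem Spaced.cyclicGet_add {d : ℕ} {R : α → α → Prop} (h : Spaced d R (l ++ l))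
    (hd : d ≤ l.length) (i : ZMod l.length) : R (cyclicGet l i) (cyclicGet l (i + d)) := by
  have hi := i.val_lt
  have := h i.val _ _ (getElem?_append_self (by omega)) (getElem?_append_self (by omega))
  rwa [Nat.cast_add, ZMod.natCast_zmod_val] at this

theorem exists_cyclicGet_of_infix {u v : α} (h : [u, v] <:+: l ++ l) :
    ∃ i, cyclicGet l i = u ∧ cyclicGet l (i + 1) = v := by
  obtain ⟨k, hk, h⟩ := List.infix_iff_getElem?.1 h
  rw [List.length_append, List.length_cons, List.length_cons, List.length_nil] at hk
  have hu := h 0 (by simp)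
  have hv := h 1 (by simp)
  rw [getElem?_append_self (by omega)] at hu hv
  exact ⟨k, by simpa using hu, by simpa [add_comm] using hv⟩

end cyclicGet

theorem arc_infix {α : Type*} (a : Dir → List α) {i : Dir} {k l : ℕ} (h : i.val + k ≤ l) :
    arc a i k <:+: arc a 0 l := by
  rw [show l = i.val + (k + (l - i.val - k)) by omega, arc_add, arc_add, zero_add,
    Fin.cast_val_eq_self]
  exact List.infix_append_of_infix_right (List.prefix_append _ _).isInfix

theorem arc_sixteen {α : Type*} (a : Dir → List α) : arc a 0 16 = arc a 0 8 ++ arc a 0 8 :=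
  arc_add a 0 8 8

theorem mem_trackSet {a : Dir → List Square} {s : Square} : s ∈ trackSet a ↔ s ∈ arc a 0 8 := by
  simp [trackSet, arc, dirArc, Fin.exists_fin_succ]

/-- The squares of a system of paths, indexed cyclically in the order of the paths. -/
def trackGet (a : Dir → List Square) [NeZero (arc a 0 8).length]
    (i : ZMod (arc a 0 8).length) : trackSet a :=
  ⟨cyclicGet _ i, mem_trackSet.2 (cyclicGet_mem i)⟩

namespace IsTrack
variable {m n x y : ℕ} {a : Dir → List Square} (T : IsTrack m n x y a)
include T

theorem length_arc_eight : (arc a 0 8).length = 4 * (x + y) := by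
  rw [arc_add _ _ 4 4, arc_add _ _ 2 2, arc_add _ _ 2 2]
  simp only [List.length_append, T.length_arc_two]
  omega

theorem four_le_length_arc_eight : 4 ≤ (arc a 0 8).length := by
  have := T.pos_x
  rw [T.length_arc_eight]
  omega

theorem neZero_length_arc_eight : NeZero (arc a 0 8).length :=
  ⟨by have := T.four_le_length_arc_eight; omega⟩

theorem card_trackSet : Nat.card (trackSet a) = 4 * (x + y) := by
  have : trackSet a = ↑(arc a 0 8).toFinset := by ext s; simpa using mem_trackSet
  rw [this, Nat.card_coe_set_eq, Set.ncard_coe_finset,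
    List.toFinset_card_of_nodup (T.nodup_arc le_rfl 0), T.length_arc_eight]

theorem shift_eq (i : Dir) : (a i ++ a (i + 1)).map (· + frameShift m n i) =
    (a (i + 5)).reverse ++ (a (i + 4)).reverse := by
  have := T.shift i
  rwa [arc_two, arc_two, List.reverse_append, add_assoc] at this

variable [NeZero (arc a 0 8).length]

theorem trackGet_bijective : (trackGet a).Bijective := by
  refine ⟨fun i j h => cyclicGet_injective (T.nodup_arc le_rfl 0) (congrArg Subtype.val h),
    fun u => ?_⟩
  obtain ⟨i, hi⟩ := exists_cyclicGet_eq (mem_trackSet.1 u.2)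
  exact ⟨i, Subtype.ext hi⟩

theorem isLeap_trackGet_add {d p q : ℕ} (hd : d ≤ 4 * (x + y))
    (h : Spaced d (IsLeap p q) (arc a 0 16)) (i : ZMod (arc a 0 8).length) :
    IsLeap p q (trackGet a i) (trackGet a (i + d)) := by
  rw [arc_sixteen] at h
  exact h.cyclicGet_add (T.length_arc_eight ▸ hd) i

theorem eq_add_one_or_eq_sub_one_of_isLeap {i j : ZMod (arc a 0 8).length}
    (h : IsLeap 0 1 (trackGet a i) (trackGet a j)) : j = i + 1 ∨ j = i - 1 := by
  obtain ⟨k, hu⟩ := (trackGet a i).2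
  obtain ⟨l, hv⟩ := (trackGet a j).2
  have huv : ∀ u ∈ [(trackGet a i).1, (trackGet a j).1], u ∈ arc a (k - 1) 3 := by
    have := eq_or_eq_add_one_or_eq_sub_one_of_isLeap T.lt (T.mem _ _ hu) (T.mem _ _ hv) h
    simp only [List.forall_mem_cons, arc_succ (k := 2), arc_two, List.mem_append, sub_add_cancel]
    grind
  have hsub : arc a (k - 1) 3 <:+: arc a 0 8 ++ arc a 0 8 := by
    rw [← arc_sixteen]
    exact arc_infix a (by omega)
  have eq_add_one {i j} (h : [(trackGet a i).1, (trackGet a j).1] <:+: arc a (k - 1) 3) :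
      j = i + 1 := by
    obtain ⟨r, hi, hj⟩ := exists_cyclicGet_of_infix (h.trans hsub)
    rw [← T.trackGet_bijective.1 (Subtype.ext hi), ← T.trackGet_bijective.1 (Subtype.ext hj)]
  refine (T.tight_arc (by norm_num) (by norm_num) (k - 1) _ (huv _ (by simp)) _ (huv _ (by simp))
    h).imp eq_add_one fun h => ?_
  rw [eq_add_one h, add_sub_cancel_right]

theorem isLeap_add_of_isLeap_add_one {d p q : ℕ} (hd : d ≤ 4 * (x + y))
    (h : Spaced d (IsLeap p q) (arc a 0 16)) {f : ℕ → trackSet a}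
    (hne : ∀ k, f (k + 2) ≠ f k) (hstep : ∀ k, IsLeap 0 1 (f k) (f (k + 1))) (k : ℕ) :
    IsLeap p q (f k) (f (k + d)) := by
  obtain ⟨σ, hσ⟩ : ∃ σ : ℕ → ZMod (arc a 0 8).length, ∀ j, trackGet a (σ j) = f (k + j) :=
    ⟨_, fun j => (T.trackGet_bijective.2 (f (k + j))).choose_spec⟩
  have hforward_or_backward := eq_add_natCast_or_eq_sub_natCast (σ := σ)
    (fun j hj => hne (k + j) (by rw [add_assoc, ← hσ, hj, hσ])) (fun j =>
      T.eq_add_one_or_eq_sub_one_of_isLeap (by rw [hσ, hσ]; exact hstep (k + j)))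
  rw [← hσ d, ← add_zero k, ← hσ 0]
  rcases hforward_or_backward with h' | h'
  · rw [h' d]
    exact T.isLeap_trackGet_add hd h _
  · refine Std.Symm.symm _ _ ?_
    convert T.isLeap_trackGet_add hd h (σ d) using 3
    rw [h' d, sub_add_cancel]

omit [NeZero (arc a 0 8).length] in
theorem exists_isProperTour (hstep : Spaced 1 (IsLeap 0 1) (arc a 0 16)) :
    ∃ (s : trackSet a) (w : (leaperGraphOn 0 1 (trackSet a)).Walk s s), IsProperTour m n w := by
  have hlen := T.four_le_length_arc_eight
  have := T.neZero_length_arc_eight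
  have hxy : 1 ≤ 4 * (x + y) := by rw [← T.length_arc_eight]; omega
  obtain ⟨w, hw, hwl, hget⟩ := exists_isHamiltonianCycle_of_bijective
    (G := leaperGraphOn 0 1 (trackSet a)) (by omega) T.trackGet_bijective (fun i => by
      rw [leaperGraphOn_adj_iff (.inr one_pos)]
      simpa using T.isLeap_trackGet_add hxy hstep i) rfl
  refine ⟨trackGet a 0, w, hw, .inl ⟨a, ?_, fun i => ⟨T.ne_nil i, T.mem i⟩, T.shift_eq⟩⟩
  · have hflatten : (List.ofFn a).flatten = arc a 0 8 := by simp [List.ofFn_succ, arc, dirArc]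
    rw [hflatten]
    refine List.IsRotated.symm ⟨1, ?_⟩
    refine List.ext_getElem (by simp [hwl]) fun k hk hk' => ?_
    rw [List.length_map, List.length_tail, SimpleGraph.Walk.length_support, hwl] at hk'
    rw [List.getElem_rotate, List.getElem_map, List.getElem_tail,
      SimpleGraph.Walk.support_getElem_eq_getVert, hget _ (by omega)]
    simp only [trackGet, cyclicGet, ZMod.val_natCast]

omit [NeZero (arc a 0 8).length] in
theorem exists_isHamiltonianCycle {d p q : ℕ} (hd : d ≤ 4 * (x + y)) (hpq : 0 < p ∨ 0 < q)
    (h : Spaced d (IsLeap p q) (arc a 0 16)) (hcop : d.Coprime (4 * (x + y)))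
    {s : trackSet a} {w : (leaperGraphOn 0 1 (trackSet a)).Walk s s} (hw : w.IsHamiltonianCycle) :
    ∃ w' : (leaperGraphOn p q (trackSet a)).Walk s s, w'.IsHamiltonianCycle ∧
      w'.length = w.length ∧ ∀ i ≤ w.length, w'.getVert i = w.getVert (d * i % w.length) := by
  obtain ⟨f, hf, hadj, hfw⟩ := exists_bijective_of_isHamiltonianCycle hw
  have := T.neZero_length_arc_eight
  have hN := hw.isCycle.three_le_length
  have := (finite_trackSet a).to_subtype
  have := Fintype.ofFinite (trackSet a)
  refine exists_isHamiltonianCycle_of_coprime hw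
    (by rwa [hw.length_eq, ← Nat.card_eq_fintype_card, T.card_trackSet]) fun i => ?_
  rw [leaperGraphOn_adj_iff hpq, ← hfw, ← hfw]
  refine T.isLeap_add_of_isLeap_add_one hd h (f := fun k => f k) (fun k hk => ?_) (fun k => ?_) i
  · have := hf.1 hk
    rw [Nat.cast_add, add_eq_left, ZMod.natCast_eq_zero_iff] at this
    exact absurd (Nat.le_of_dvd two_pos this) (by omega)
  · rw [Nat.cast_succ]
    exact (hadj k).2

end IsTrack

/-! ### Words of liftings -/

section baseTrack

/-- The paths of the cycle of the knight on the `3 × 3` board, one square in each section. -/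
def baseTrack (i : Dir) : List Square := [dirVec i]

theorem mem_trackSet_baseTrack {s : Square} : s ∈ trackSet baseTrack ↔ ∃ i, dirVec i = s := by
  simp [trackSet, baseTrack, eq_comm]

theorem trackSet_baseTrack : trackSet baseTrack = frame 1 2 := by
  ext ⟨x, y⟩
  simp only [mem_trackSet_baseTrack, frame, board, Set.mem_sdiff, Set.mem_ofPred_eq, abs_lt]
  constructor
  · rintro ⟨i, hi⟩
    obtain ⟨rfl, rfl⟩ := Prod.ext_iff.1 hi
    fin_cases i <;> simp [dirVec]
  · rintro ⟨⟨⟨h₁, h₂⟩, h₃, h₄⟩, h₅⟩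
    obtain rfl | rfl | rfl : x = -1 ∨ x = 0 ∨ x = 1 := by omega
    all_goals obtain rfl | rfl | rfl : y = -1 ∨ y = 0 ∨ y = 1 := by omega
    all_goals first | decide | exact absurd h₅ (by simp)

theorem isTrack_baseTrack : IsTrack 1 2 1 1 baseTrack where
  pos := one_pos
  lt := one_lt_two
  pos_x := one_pos
  pos_y := one_pos
  length_eq _ := (ite_self 1).symm
  mem i s hs := by
    rw [List.mem_singleton.1 hs]
    fin_cases i <;> simp [frameSection, strip_zero_iff, strip_one_iff, strip_neg_one_iff, dirVec]
  nodup _ := List.nodup_singleton _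
  shift i := by fin_cases i <;> rfl
  tight i := by
    have not_isLeap_self (u : Square) : ¬ IsLeap 0 1 u u := by simp [IsLeap, IsMove]
    rw [arc_two]
    intro u hu v hv huv
    obtain rfl | rfl : u = dirVec i ∨ u = dirVec (i + 1) := by simpa [baseTrack] using hu
    all_goals obtain rfl | rfl : v = dirVec i ∨ v = dirVec (i + 1) := by simpa [baseTrack] using hv
    · exact absurd huv (not_isLeap_self _)
    · exact .inl List.infix_rfl
    · exact .inr List.infix_rfl
    · exact absurd huv (not_isLeap_self _)

open scoped Fin.CommRing in
theorem joined_baseTrack : ∀ u ∈ trackSet baseTrack, ∀ v ∈ trackSet baseTrack,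
    Joined 1 2 (trackSet baseTrack) u v := by
  have hmem (i : Dir) : dirVec i ∈ trackSet baseTrack := mem_trackSet_baseTrack.2 ⟨i, rfl⟩
  have isLeap_add_three (i : Dir) : IsLeap 1 2 (dirVec i) (dirVec (i + 3)) := by
    fin_cases i <;> simp [IsLeap, IsMove, dirVec]
  have joined_add (k : ℕ) (i : Dir) :
      Joined 1 2 (trackSet baseTrack) (dirVec i) (dirVec (i + 3 * k)) := by
    induction k with
    | zero => simpa using Joined.refl (hmem i)
    | succ k ih =>
      rw [Nat.cast_succ, mul_add, mul_one, ← add_assoc]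
      exact ih.trans (.of_isLeap (.inl one_pos) (hmem _) (hmem _) (isLeap_add_three _))
  intro u hu v hv
  obtain ⟨i, rfl⟩ := mem_trackSet_baseTrack.1 hu
  obtain ⟨j, rfl⟩ := mem_trackSet_baseTrack.1 hv
  obtain ⟨k, rfl⟩ : ∃ k : Fin 8, j = i + 3 * (k.val : Dir) := by
    clear hu hv
    decide +revert
  exact joined_add k i

end baseTrack

/-- The track of the oldest cycle of the leaper of the given descent. -/
def trackOfWord : List Lifting → Dir → List Square
  | [] => baseTrack
  | t :: e => t.path (frameOfWord e).1 (frameOfWord e).2 (trackOfWord e)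

/-- The lengths of the paths of `trackOfWord` in the sections to the sides and at the corners of
the hole. -/
def lengthsOfWord : List Lifting → ℕ × ℕ
  | [] => (1, 1)
  | t :: e => t.lengths (lengthsOfWord e)

theorem isTrack_trackOfWord (e : List Lifting) :
    IsTrack (frameOfWord e).1 (frameOfWord e).2 (lengthsOfWord e).1 (lengthsOfWord e).2
      (trackOfWord e) := by
  induction e with
  | nil => exact isTrack_baseTrack
  | cons t e ih => exact ih.lift t

theorem isCycleSet_trackOfWord (e : List Lifting) :
    IsCycleSet (frameOfWord e).1 (frameOfWord e).2 (trackSet (trackOfWord e)) := by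
  refine (isTrack_trackOfWord e).isCycleSet ?_
  induction e with
  | nil => exact joined_baseTrack
  | cons t e ih => exact (isTrack_trackOfWord e).joined_lift t ih

theorem Lifting.coprime_target (t : Lifting) {m n : ℕ} (hmn : m < n) (h : m.Coprime n) :
    (t.target (m, n)).1.Coprime (t.target (m, n)).2 := by
  cases t <;> simp only [target]
  · simpa [add_comm] using h
  · rw [two_mul, Nat.add_sub_assoc hmn.le, Nat.coprime_self_add_right,
      Nat.coprime_self_sub_right hmn.le]
    exact h.symm
  · simpa using h.symm

theorem Lifting.coprime_lengths (t : Lifting) {x y : ℕ} (h : x.Coprime y) :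
    (t.lengths (x, y)).1.Coprime (t.lengths (x, y)).2 := by
  cases t <;> simp only [lengths]
  · simpa using h
  · simpa using h
  · rw [show 3 * x + 2 * y = x + y + (2 * x + y) by ring, Nat.coprime_add_self_left,
      show 2 * x + y = x + (x + y) by ring, Nat.coprime_add_self_right, Nat.coprime_comm]
    simpa using h

theorem coprime_frameOfWord (e : List Lifting) : (frameOfWord e).1.Coprime (frameOfWord e).2 := by
  induction e with
  | nil => decide
  | cons t e ih => exact t.coprime_target (isTrack_trackOfWord e).lt ih

theorem coprime_lengthsOfWord (e : List Lifting) :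
    (lengthsOfWord e).1.Coprime (lengthsOfWord e).2 := by
  induction e with
  | nil => decide
  | cons t e ih => exact t.coprime_lengths ih

section spaced

instance (p q : ℕ) (u v : Square) : Decidable (IsLeap p q u v) := by
  unfold IsLeap IsMove
  infer_instance

theorem spaced_of_getD {α : Type*} {d : ℕ} {R : α → α → Prop} {l : List α} (s : α)
    (h : ∀ k < l.length - d, R (l.getD k s) (l.getD (k + d) s)) : Spaced d R l := by
  intro k u v hu hv
  have hk : k + d < l.length := (List.getElem?_eq_some_iff.1 hv).1
  have := h k (by omega)
  rwa [List.getD, List.getD, hu, hv] at this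

theorem spaced_step_trackOfWord (e : List Lifting) :
    Spaced 1 (IsLeap 0 1) (arc (trackOfWord e) 0 16) := by
  have one_le (e : List Lifting) : 1 ≤ (lengthsOfWord e).1 + (lengthsOfWord e).2 :=
    Nat.le_add_right_of_le (isTrack_trackOfWord e).pos_x
  refine (isTrack_trackOfWord e).spaced_arc (one_le e) (fun i => ?_) (by norm_num) 0
  induction e generalizing i with
  | nil =>
    refine spaced_of_getD 0 ?_
    decide +revert
  | cons t e ih => exact (isTrack_trackOfWord e).spaced_lift (one_le e) ih i

theorem three_le_lengthsOfWord {e : List Lifting} (he : e ≠ []) :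
    3 ≤ (lengthsOfWord e).1 + (lengthsOfWord e).2 := by
  obtain ⟨t, e, rfl⟩ := List.exists_cons_of_ne_nil he
  have hx := (isTrack_trackOfWord e).pos_x
  have hy := (isTrack_trackOfWord e).pos_y
  rw [lengthsOfWord]
  generalize lengthsOfWord e = r at hx hy
  cases t <;> simp only [Lifting.lengths] <;> omega

theorem spaced_knight_trackOfWord {e : List Lifting}
    (he : e = [] ∨ e.getLast? = some .g ∨ e.getLast? = some .h) :
    Spaced 3 (IsLeap 1 2) (arc (trackOfWord e) 0 16) := by
  rcases e.eq_nil_or_concat' with rfl | ⟨e, t, rfl⟩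
  · refine spaced_of_getD 0 ?_
    decide
  have ht : t = .g ∨ t = .h := by simpa using he
  have three_le (e : List Lifting) := three_le_lengthsOfWord (List.append_ne_nil_of_right_ne_nil e
    (List.cons_ne_nil t []))
  refine (isTrack_trackOfWord _).spaced_arc (three_le e) (fun i => ?_) (by norm_num) 0
  clear he
  induction e generalizing i with
  | nil =>
    refine spaced_of_getD 0 ?_
    rcases ht with rfl | rfl <;> decide +revert
  | cons s e ih => exact (isTrack_trackOfWord (e ++ [t])).spaced_lift (three_le e) ih i

end spaced

theorem Lifting.target_injective {t t' : Lifting} {m n m' n' : ℕ} (hm : 0 < m) (hmn : m < n)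
    (hm' : 0 < m') (hmn' : m' < n') (h : t.target (m, n) = t'.target (m', n')) :
    t = t' ∧ (m, n) = (m', n') := by
  cases t <;> cases t' <;> simp only [target, Prod.mk.injEq, reduceCtorEq, false_and,
    true_and] at h ⊢ <;> omega

theorem Lifting.target_ne_one_two {t : Lifting} {m n : ℕ} (hm : 0 < m) (hmn : m < n) :
    t.target (m, n) ≠ (1, 2) := by
  cases t <;> simp only [target, ne_eq, Prod.mk.injEq] <;> omega

theorem frameOfWord_injective : Function.Injective frameOfWord := by
  have frameOfWord_cons_ne (t : Lifting) (e : List Lifting) : frameOfWord (t :: e) ≠ (1, 2) :=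
    Lifting.target_ne_one_two (isTrack_trackOfWord e).pos (isTrack_trackOfWord e).lt
  intro e
  induction e with
  | nil =>
    rintro (_ | ⟨t, e'⟩) h
    exacts [rfl, absurd h.symm (frameOfWord_cons_ne t e')]
  | cons t e ih =>
    rintro (_ | ⟨t', e'⟩) h
    · exact absurd h (frameOfWord_cons_ne t e)
    have T := isTrack_trackOfWord e
    have T' := isTrack_trackOfWord e'
    obtain ⟨rfl, hframe⟩ := Lifting.target_injective T.pos T.lt T'.pos T'.lt h
    rw [ih hframe]

theorem IsDescent.unique {p q : ℕ} {e e' : List Lifting} (h : IsDescent p q e)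
    (h' : IsDescent p q e') : e = e' :=
  frameOfWord_injective (Eq.trans h (Eq.symm h'))

/-- The number of letters `g` and `h` of a word, one less than the type of the oldest cycle. -/
def depth : List Lifting → ℕ
  | [] => 0
  | .f :: e => depth e
  | .g :: e => depth e + 1
  | .h :: e => depth e + 1

theorem lift_trackSet_trackOfWord (t : Lifting) (e : List Lifting) :
    t.lift (frameOfWord e).1 (frameOfWord e).2 (trackSet (trackOfWord e)) =
      trackSet (trackOfWord (t :: e)) :=
  (isTrack_trackOfWord e).lift_trackSet t

theorem cycleOfWord_trackOfWord (e : List Lifting) :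
    CycleOfWord e (depth e + 1) (trackSet (trackOfWord e)) := by
  induction e with
  | nil => exact trackSet_baseTrack ▸ .base
  | cons t e ih =>
    rw [← lift_trackSet_trackOfWord]
    cases t
    exacts [.lift_f ih, .lift_g ih, .lift_h ih]

theorem CycleOfWord.eq_trackSet {e : List Lifting} {i : ℕ} {S : Set Square}
    (h : CycleOfWord e i S) (hi : i = depth e + 1) : S = trackSet (trackOfWord e) := by
  induction h with
  | base => exact trackSet_baseTrack.symm
  | lift_f _ ih => rw [← lift_trackSet_trackOfWord, ih hi]
  | lift_g _ ih | lift_h _ ih => rw [← lift_trackSet_trackOfWord, ih (Nat.succ_injective hi)]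
  | shell_g | shell_h => simp [depth] at hi

theorem IsDescent.isCycleOfType_iff {p q : ℕ} {e : List Lifting} (h : IsDescent p q e)
    {S : Set Square} : IsCycleOfType p q (depth e + 1) S ↔ S = trackSet (trackOfWord e) := by
  constructor
  · rintro ⟨e', he', hS⟩
    obtain rfl := h.unique he'
    exact hS.eq_trackSet rfl
  · rintro rfl
    exact ⟨e, h, cycleOfWord_trackOfWord e⟩

/-! ### Even continued fractions -/

theorem cfValue_cons (c : ℕ) (s : ℤˣ) (init : List (ℕ × ℤˣ)) (last : ℕ) :
    cfValue ((c, s) :: init) last = c + ((s : ℤ) : ℚ) / cfValue init last := rfl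

theorem interleavedValue_cons (c : ℕ) (s : ℤˣ) (init : List (ℕ × ℤˣ)) (last : ℕ) :
    interleavedValue ((c, s) :: init) last =
      c + ((s : ℤ) : ℚ) / (2 - 1 / interleavedValue init last) := by
  simp [interleavedValue, cfValue, ← sub_eq_add_neg, neg_div]

/-- An even continued fraction whose first term is positive as well. -/
def IsPositiveEvenCF (init : List (ℕ × ℤˣ)) (last : ℕ) : Prop :=
  ∀ c ∈ init.map Prod.fst ++ [last], Even c ∧ 0 < c

namespace IsPositiveEvenCF
variable {init : List (ℕ × ℤˣ)} {last c : ℕ} {s : ℤˣ}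

theorem cons_iff : IsPositiveEvenCF ((c, s) :: init) last ↔
    (Even c ∧ 0 < c) ∧ IsPositiveEvenCF init last :=
  List.forall_mem_cons

theorem even_last (h : IsPositiveEvenCF init last) : Even last := (h _ (by simp)).1

theorem last_pos (h : IsPositiveEvenCF init last) : 0 < last := (h _ (by simp)).2

end IsPositiveEvenCF

/-- The word that an even continued fraction spells out: each term `c` contributes `c / 2 - 1`
letters `f`, and each sign contributes a letter `h` or `g`. -/
def wordOfCF : List (ℕ × ℤˣ) → ℕ → List Lifting
  | [], last => .replicate ((last - 2) / 2) .f
  | (c, s) :: init, last =>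
    .replicate ((c - 2) / 2) .f ++ (if s = 1 then .h else .g) :: wordOfCF init last

section replicate
variable (k : ℕ) (e : List Lifting)

theorem frameOfWord_replicate_append : frameOfWord (.replicate k .f ++ e) =
    ((frameOfWord e).1, (frameOfWord e).2 + 2 * k * (frameOfWord e).1) := by
  induction k with
  | zero => simp
  | succ k ih =>
    rw [List.replicate_succ, List.cons_append, frameOfWord, ih]
    simp only [Lifting.target, Prod.mk.injEq, true_and]
    ring

theorem lengthsOfWord_replicate_append : lengthsOfWord (.replicate k .f ++ e) =
    ((lengthsOfWord e).1 + 2 * k * (lengthsOfWord e).2, (lengthsOfWord e).2) := by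
  induction k with
  | zero => simp
  | succ k ih =>
    rw [List.replicate_succ, List.cons_append, lengthsOfWord, ih]
    simp only [Lifting.lengths, Prod.mk.injEq, and_true]
    ring

theorem depth_replicate_append : depth (.replicate k .f ++ e) = depth e := by
  induction k with
  | zero => rfl
  | succ _ ih => exact ih

end replicate

section wordOfCF
variable {init : List (ℕ × ℤˣ)} {last : ℕ}

theorem depth_wordOfCF (init : List (ℕ × ℤˣ)) (last : ℕ) :
    depth (wordOfCF init last) = init.length := by
  induction init with
  | nil => simpa [wordOfCF, depth] using depth_replicate_append ((last - 2) / 2) []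
  | cons t init ih =>
    rw [wordOfCF, depth_replicate_append, List.length_cons, ← ih]
    split_ifs <;> rfl

theorem wordOfCF_eq_nil_or_getLast?_iff (heven : Even last) (hpos : 0 < last) :
    wordOfCF init last = [] ∨ (wordOfCF init last).getLast? = some .g ∨
      (wordOfCF init last).getLast? = some .h ↔ last = 2 := by
  obtain ⟨r, rfl⟩ := heven
  induction init with
  | nil =>
    rw [wordOfCF, List.getLast?_replicate, List.replicate_eq_nil_iff]
    split_ifs <;> simp <;> omega
  | cons t init ih =>
    refine Iff.trans ?_ ih
    rw [wordOfCF]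
    cases hw : wordOfCF init (r + r) with
    | nil => simpa using em' _
    | cons s w => simp [List.getLast?_append, List.getLast?_cons_cons]

theorem two_add_two_mul_sub_two_div_two {c : ℕ} (heven : Even c) (hpos : 0 < c) :
    (2 + 2 * ((c - 2) / 2 : ℕ) : ℚ) = c := by
  obtain ⟨r, rfl⟩ := heven
  exact_mod_cast (by omega : 2 + 2 * ((r + r - 2) / 2) = r + r)

theorem cfValue_wordOfCF (h : IsPositiveEvenCF init last) : cfValue init last =
    (frameOfWord (wordOfCF init last)).2 / (frameOfWord (wordOfCF init last)).1 := by
  induction init with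
  | nil =>
    rw [wordOfCF, ← List.append_nil (List.replicate _ _), frameOfWord_replicate_append]
    simp [cfValue, frameOfWord, two_add_two_mul_sub_two_div_two h.even_last h.last_pos]
  | cons t init ih =>
    obtain ⟨c, s⟩ := t
    obtain ⟨hc, h⟩ := IsPositiveEvenCF.cons_iff.1 h
    have T := isTrack_trackOfWord (wordOfCF init last)
    have hm := T.pos
    have hmn := T.lt
    rw [cfValue_cons, ih h, wordOfCF, frameOfWord_replicate_append, frameOfWord,
      ← two_add_two_mul_sub_two_div_two hc.1 hc.2]
    generalize frameOfWord (wordOfCF init last) = r at hm hmn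
    obtain ⟨m, n⟩ := r
    have hmn₂ : m ≤ 2 * n := by
      dsimp only at hmn
      omega
    have hn : (n : ℚ) ≠ 0 := Nat.cast_ne_zero.2 (hm.trans hmn).ne'
    rcases Int.units_eq_one_or s with rfl | rfl
    · simp only [Lifting.target, if_true, Units.val_one, Int.cast_one, Nat.cast_add, Nat.cast_mul,
        Nat.cast_ofNat]
      field_simp
      ring
    · simp only [Lifting.target, neg_units_ne_self, if_false, Units.val_neg, Units.val_one,
        Int.cast_neg, Int.cast_one, Nat.cast_add, Nat.cast_sub hmn₂, Nat.cast_mul, Nat.cast_ofNat]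
      field_simp
      ring

theorem interleavedValue_wordOfCF (h : IsPositiveEvenCF init last) : interleavedValue init last =
    ((lengthsOfWord (wordOfCF init last)).1 + (lengthsOfWord (wordOfCF init last)).2) /
      (lengthsOfWord (wordOfCF init last)).2 := by
  induction init with
  | nil =>
    rw [wordOfCF, ← List.append_nil (List.replicate _ _), lengthsOfWord_replicate_append]
    simp only [interleavedValue, cfValue, lengthsOfWord, List.flatMap_nil, List.foldr_nil,
      ← two_add_two_mul_sub_two_div_two h.even_last h.last_pos]
    push_cast
    ring
  | cons t init ih =>
    obtain ⟨c, s⟩ := t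
    obtain ⟨hc, h⟩ := IsPositiveEvenCF.cons_iff.1 h
    have T := isTrack_trackOfWord (wordOfCF init last)
    have hx := T.pos_x
    have hy := T.pos_y
    rw [interleavedValue_cons, ih h, wordOfCF, lengthsOfWord_replicate_append, lengthsOfWord,
      ← two_add_two_mul_sub_two_div_two hc.1 hc.2]
    generalize lengthsOfWord (wordOfCF init last) = r at hx hy
    obtain ⟨x, y⟩ := r
    have hdenom : 2 - 1 / ((x + y) / y : ℚ) = (2 * x + y) / (x + y) := by
      field_simp
      ring
    simp only [hdenom]
    rcases Int.units_eq_one_or s with rfl | rfl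
    all_goals
      simp only [Lifting.lengths, neg_units_ne_self, if_true, if_false, Units.val_neg,
        Units.val_one, Int.cast_neg, Int.cast_one, Nat.cast_add, Nat.cast_mul, Nat.cast_ofNat]
      field_simp
      ring

theorem num_interleavedValue_wordOfCF (h : IsPositiveEvenCF init last) :
    (interleavedValue init last).num =
      ((lengthsOfWord (wordOfCF init last)).1 + (lengthsOfWord (wordOfCF init last)).2 : ℕ) := by
  have hcop := coprime_lengthsOfWord (wordOfCF init last)
  have hy := (isTrack_trackOfWord (wordOfCF init last)).pos_y
  have := Rat.num_div_eq_of_coprime (a := ((lengthsOfWord (wordOfCF init last)).1 +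
    (lengthsOfWord (wordOfCF init last)).2 : ℕ)) (Int.natCast_pos.2 hy)
    (Nat.coprime_add_self_left.2 hcop)
  rw [interleavedValue_wordOfCF h]
  simpa only [Nat.cast_add, Int.cast_add, Int.cast_natCast] using this

theorem one_lt_cfValue (h : IsPositiveEvenCF init last) : 1 < cfValue init last := by
  have T := isTrack_trackOfWord (wordOfCF init last)
  rw [cfValue_wordOfCF h, one_lt_div (Nat.cast_pos.2 T.pos)]
  exact Nat.cast_lt.2 T.lt

theorem IsEvenCF.isPositiveEvenCF (hcf : IsEvenCF init last) (h : 1 < cfValue init last) :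
    IsPositiveEvenCF init last := by
  cases init with
  | nil =>
    refine List.forall_mem_singleton.2 ⟨hcf.1 last (by simp), Nat.pos_of_ne_zero ?_⟩
    rintro rfl
    norm_num [cfValue] at h
  | cons t init =>
    obtain ⟨c, s⟩ := t
    have htail : IsPositiveEvenCF init last := fun d hd => ⟨hcf.1 d (.tail _ hd), hcf.2 d hd⟩
    refine IsPositiveEvenCF.cons_iff.2 ⟨⟨hcf.1 c (.head _), Nat.pos_of_ne_zero ?_⟩, htail⟩
    rintro rfl
    have hlt := one_lt_cfValue htail
    rw [cfValue_cons, Nat.cast_zero, zero_add, one_lt_div (by linarith)] at h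
    rcases Int.units_eq_one_or s with rfl | rfl <;> norm_num at h <;> linarith

theorem isDescent_wordOfCF {p q : ℕ} (hp : 0 < p) (hcop : p.Coprime q)
    (h : IsPositiveEvenCF init last) (hval : cfValue init last = (q : ℚ) / p) :
    IsDescent p q (wordOfCF init last) := by
  have T := isTrack_trackOfWord (wordOfCF init last)
  obtain ⟨hq, hp⟩ := Rat.div_int_inj (a := (frameOfWord (wordOfCF init last)).2) (c := q)
    (Int.natCast_pos.2 T.pos) (Int.natCast_pos.2 hp)
    (coprime_frameOfWord (wordOfCF init last)).symm hcop.symm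
    (by simpa only [Int.cast_natCast] using (cfValue_wordOfCF h).symm.trans hval)
  exact Prod.ext (Int.natCast_inj.1 hp) (Int.natCast_inj.1 hq)

end wordOfCF

end Leaper

theorem mainTheorem4_general (p q : ℕ) (hp : 0 < p) (hpq : p < q) (hcop : Nat.Coprime p q)
    (init : List (ℕ × ℤˣ)) (last : ℕ) (hcf : Leaper.IsEvenCF init last)
    (hval : Leaper.cfValue init last = (q : ℚ) / (p : ℚ)) :
    (∀ e : List Leaper.Lifting, Leaper.IsDescent p q e →
      (last = 2 ↔ e = [] ∨ e.getLast? = some .g ∨ e.getLast? = some .h)) ∧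
    ∃ C : Set Leaper.Square,
      (∀ S : Set Leaper.Square, Leaper.IsCycleOfType p q (init.length + 1) S ↔ S = C) ∧
      Leaper.IsCycleSet p q C ∧
      (∃ (a : C) (w : (Leaper.leaperGraphOn 0 1 C).Walk a a), Leaper.IsProperTour p q w) ∧
      (last = 2 → ¬ (3 : ℤ) ∣ (Leaper.interleavedValue init last).num →
        ∀ (a : C) (w : (Leaper.leaperGraphOn 0 1 C).Walk a a), w.IsHamiltonianCycle →
          ∃ w' : (Leaper.leaperGraphOn 1 2 C).Walk a a, w'.IsHamiltonianCycle ∧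
            w'.length = w.length ∧
            ∀ i ≤ w.length, w'.getVert i = w.getVert (3 * i % w.length)) := by
  have hpos := hcf.isPositiveEvenCF (by rwa [hval, one_lt_div₀ (mod_cast hp), Nat.cast_lt])
  have hdesc := Leaper.isDescent_wordOfCF hp hcop hpos hval
  have hlast := Leaper.wordOfCF_eq_nil_or_getLast?_iff (init := init) hpos.even_last hpos.last_pos
  have hframe : Leaper.frameOfWord (Leaper.wordOfCF init last) = (p, q) := hdesc
  have T := Leaper.isTrack_trackOfWord (Leaper.wordOfCF init last)
  have hset := Leaper.isCycleSet_trackOfWord (Leaper.wordOfCF init last)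
  have hstep := Leaper.spaced_step_trackOfWord (Leaper.wordOfCF init last)
  rw [hframe] at T hset
  refine ⟨fun e he => he.unique hdesc ▸ hlast.symm, _, fun S => ?_, hset,
    T.exists_isProperTour hstep, fun h₂ h₃ a w hw => ?_⟩
  · rw [← Leaper.depth_wordOfCF init last]
    exact hdesc.isCycleOfType_iff
  · have hknight := Leaper.spaced_knight_trackOfWord (hlast.2 h₂)
    have hlen := T.four_le_length_arc_eight
    rw [T.length_arc_eight] at hlen
    rw [Leaper.num_interleavedValue_wordOfCF hpos] at h₃
    have hcop₃ := Nat.Coprime.mul_right (by norm_num : Nat.Coprime 3 4)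
      (Nat.prime_three.coprime_iff_not_dvd.2 fun h => h₃ (mod_cast h))
    exact T.exists_isHamiltonianCycle (by omega) (.inl one_pos) hknight hcop₃ hw

theorem mainTheorem4 (p q : ℕ) (hp : 0 < p) (hpq : p < q) (hodd : Odd (p + q))
    (hcop : Nat.Coprime p q)
    -- the representation of `q / p` as an even continued fraction, with `k = init.length + 1` terms
    (init : List (ℕ × ℤˣ)) (last : ℕ) (hcf : Leaper.IsEvenCF init last)
    (hval : Leaper.cfValue init last = (q : ℚ) / (p : ℚ)) :
    (∀ e : List Leaper.Lifting, Leaper.IsDescent p q e →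
      (last = 2 ↔ e = [] ∨ e.getLast? = some .g ∨ e.getLast? = some .h)) ∧
    (last = 2 → ¬ (3 : ℤ) ∣ (Leaper.interleavedValue init last).num →
      ∃ C : Set Leaper.Square,
        -- `C` is the unique cycle of type `k`
        (∀ S : Set Leaper.Square, Leaper.IsCycleOfType p q (init.length + 1) S ↔ S = C) ∧
        Leaper.IsCycleSet p q C ∧
        -- a proper Hamiltonian cycle of the `(0, 1)`-leaper over `C` exists
        (∃ (a : C) (w : (Leaper.leaperGraphOn 0 1 C).Walk a a), Leaper.IsProperTour p q w) ∧
        -- taking every third square of it yields a Hamiltonian cycle of the `(1, 2)`-leaper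
        (∀ (a : C) (w : (Leaper.leaperGraphOn 0 1 C).Walk a a), Leaper.IsProperTour p q w →
          ∃ w' : (Leaper.leaperGraphOn 1 2 C).Walk a a, w'.IsHamiltonianCycle ∧
            w'.length = w.length ∧
            ∀ i ≤ w.length, w'.getVert i = w.getVert (3 * i % w.length))) := by
  obtain ⟨hlast, C, hC, hset, htour, hknight⟩ :=
    mainTheorem4_general p q hp hpq hcop init last hcf hval
  exact ⟨hlast, fun h₂ h₃ => ⟨C, hC, hset, htour, fun a w hw => hknight h₂ h₃ a w hw.1⟩⟩
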